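/- **Notation.** $(a)_n=a(a+1)\cdots(a+n-1)$, $\Gamma(\mathbf a_p)=\prod_{i=1}^p\Gamma(a_i)$, and $1/\Gamma$ denotes the entire function. Define the series $${}_pM_q^{\xi,\eta}(w)=\sum_{n\ge0}\frac{(a_1)_n\cdots(a_p)_n}{(b_1)_n\cdots(b_q)_n}\frac{w^n}{\Gamma(\xi n+\eta)},\qquad {}_pK_q^{\xi,\eta;\nu}(w)=\sum_{n\ge0}\frac{(a_1)_n\cdots(a_p)_n}{(b_1)_n\cdots(b_q)_n}\frac{(\nu)_n}{\Gamma(\xi n+\eta)}\frac{w^n}{n!},$$ $${}_p\psi_q\!\left({(A_i,\kappa_i)_1^p\atop (B_j,\lambda_j)_1^q};w\right)=\sum_{n\ge0}\frac{\prod_{i}\Gamma(A_i+\kappa_i n)}{\prod_{j}\Gamma(B_j+\lambda_j n)}\frac{w^n}{n!}.$$ Let $F_3(\alpha,\alpha',\beta,\beta';\gamma;x,y)$ be Appell's function, i.e. the analytic continuation, along the segment from $(0,0)$ to $(x,y)$, of $$\sum_{m,n\ge0}\frac{(\alpha)_m(\alpha')_n(\beta)_m(\beta')_n}{(\gamma)_{m+n}}\frac{x^m}{m!}\frac{y^n}{n!}\qquad(\max(|x|,|y|)<1).$$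 For $\Re(\gamma)>0$ and $x>0$, Saigo–Maeda's left-sided fractional integral is $$(\mathcal I_{0+}^{\alpha,\alpha',\beta,\beta',\gamma}f)(x)=\frac{x^{-\alpha}}{\Gamma(\gamma)}\int_0^x (x-t)^{\gamma-1}t^{-\alpha'}F_3\!\left(\alpha,\alpha',\beta,\beta';\gamma;1-\tfrac tx,1-\tfrac xt\right)f(t)\,dt,$$ and, with $n=\lfloor\Re(\gamma)\rfloor+1$, Saigo–Maeda's left-sided fractional derivative is $$(\mathcal D_{0+}^{\alpha,\alpha',\beta,\beta',\gamma}f)(x)=\Big(\frac{d}{dx}\Big)^{n}\big(\mathcal I_{0+}^{-\alpha',-\alpha,-\beta'+n,-\beta,-\gamma+n}f\big)(x).$$ **Theorem.** Let $p,q\ge 0$ be integers, $\alpha,\alpha',\beta,\beta',\gamma,\eta,\nu,\xi,\sigma\in\mathbb C$ with $\Re(\nu)>0$, $\Re(\xi)>0$, $\Re(\gamma)>0$, let $\mu>0$, $c\in\mathbb R$, $z>0$, and let $a_1,\dots,a_p,b_1,\dots,b_q\in\mathbb C\setminus\{0,-1,-2,\dots\}$. Then $$\mathcal D_{0+}^{\alpha,\alpha',\beta,\beta',\gamma}\Big(t^{\sigma-1}\,{}_pM_q^{\xi,\eta}(ct^\mu)\Big)(z)=\frac{\Gamma(\mathbf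 b_q)}{\Gamma(\mathbf a_p)}\,z^{\sigma+\alpha+\alpha'-\gamma-1}\;{}_{p+4}\psi_{q+4}\!\left({(a_i,1)_1^p,(\sigma,\mu),(\sigma+\alpha+\alpha'+\beta'-\gamma,\mu),(\sigma+\alpha-\beta,\mu),(1,1)\atop (b_j,1)_1^q,(\sigma+\alpha+\alpha'-\gamma,\mu),(\sigma+\alpha+\beta'-\gamma,\mu),(\sigma-\beta,\mu),(\eta,\xi)};cz^\mu\right)$$ and $$\mathcal D_{0+}^{\alpha,\alpha',\beta,\beta',\gamma}\Big(t^{\sigma-1}\,{}_pK_q^{\xi,\eta;\nu}(ct^\mu)\Big)(z)=\frac{\Gamma(\mathbf b_q)}{\Gamma(\mathbf a_p)}\,\frac{z^{\sigma+\alpha+\alpha'-\gamma-1}}{\Gamma(\nu)}\;{}_{p+4}\psi_{q+4}\!\left({(a_i,1)_1^p,(\sigma,\mu),(\sigma+\alpha+\alpha'+\beta'-\gamma,\mu),(\sigma+\alpha-\beta,\mu),(\nu,1)\atop (b_j,1)_1^q,(\sigma+\alpha+\alpha'-\gamma,\mu),(\sigma+\alpha+\beta'-\gamma,\mu),(\sigma-\beta,\mu),(\eta,\xi)};cz^\mu\right),$$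 each formula holding provided that its members exist, in the following sense. For the left side: for all $x$ in a neighbourhood of $z$, the series ${}_pM_q^{\xi,\eta}(ct^\mu)$ (resp. ${}_pK_q^{\xi,\eta;\nu}(ct^\mu)$) converges absolutely for every $0<t<x$, and the integral $\mathcal I_{0+}^{-\alpha',-\alpha,-\beta'+n,-\beta,-\gamma+n}$ of $t^{\sigma-1}\,{}_pM_q^{\xi,\eta}(ct^\mu)$ (resp. of $t^{\sigma-1}\,{}_pK_q^{\xi,\eta;\nu}(ct^\mu)$) at $x$ converges absolutely. For the right side: no Gamma factor in the numerator of the ${}_{p+4}\psi_{q+4}$-series is evaluated at a pole. Under these provisos the function to be differentiated is moreover $n$ times continuously differentiable at $z$, and the ${}_{p+4}\psi_{q+4}$-series converges absolutely at $cz^\mu$. -/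

import Mathlib

open scoped Topology

noncomputable section

/-- The Pochhammer symbol `(a)_n = a (a + 1) ⋯ (a + n - 1)`. -/
def poch (a : ℂ) (n : ℕ) : ℂ := (ascPochhammer ℂ n).eval a

/-- `s` is a pole of the Gamma function, that is, a non-positive integer. -/
def IsGammaPole (s : ℂ) : Prop := ∃ m : ℕ, s = -(m : ℂ)

/-- The `n`-th term of the Fox–Wright series with top parameters `A i = (aᵢ, αᵢ)` and bottom
parameters `B j = (bⱼ, βⱼ)`. At a pole of `Γ` Mathlib's `Complex.Gamma` is `0`, so the factors
`1 / Γ` are the entire function `1 / Γ` everywhere. -/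
def foxWrightTerm {p q : ℕ} (A : Fin p → ℂ × ℂ) (B : Fin q → ℂ × ℂ) (z : ℂ) (n : ℕ) : ℂ :=
  (∏ i, Complex.Gamma ((A i).1 + (A i).2 * n)) / (∏ j, Complex.Gamma ((B j).1 + (B j).2 * n)) *
    (z ^ n / (n.factorial : ℂ))

/-- No factor in the numerator of the Fox–Wright series is evaluated at a pole of `Γ`. -/
def FoxWrightDefined {p : ℕ} (A : Fin p → ℂ × ℂ) : Prop :=
  ∀ i (n : ℕ), ¬ IsGammaPole ((A i).1 + (A i).2 * n)

/-- The generalized Fox–Wright function `ₚψ_q`. -/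
def foxWright {p q : ℕ} (A : Fin p → ℂ × ℂ) (B : Fin q → ℂ × ℂ) (z : ℂ) : ℂ :=
  ∑' n : ℕ, foxWrightTerm A B z n

/-- The `n`-th term of the generalized `M`-series `ₚM_q^{ξ,η}(z)`. -/
def mSeriesTerm {p q : ℕ} (a : Fin p → ℂ) (b : Fin q → ℂ) (ξ η : ℂ) (z : ℂ) (n : ℕ) : ℂ :=
  (∏ i, poch (a i) n) / (∏ j, poch (b j) n) * (z ^ n / Complex.Gamma (ξ * n + η))

/-- The generalized `M`-series `ₚM_q^{ξ,η}(z)`. -/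
def mSeries {p q : ℕ} (a : Fin p → ℂ) (b : Fin q → ℂ) (ξ η : ℂ) (z : ℂ) : ℂ :=
  ∑' n : ℕ, mSeriesTerm a b ξ η z n

/-- The `n`-th term of the `K`-function `ₚK_q^{ξ,η;ν}(z)`. -/
def kFunctionTerm {p q : ℕ} (a : Fin p → ℂ) (b : Fin q → ℂ) (ξ η ν : ℂ) (z : ℂ) (n : ℕ) : ℂ :=
  (∏ i, poch (a i) n) / (∏ j, poch (b j) n) *
    (poch ν n / Complex.Gamma (ξ * n + η) * (z ^ n / (n.factorial : ℂ)))

/-- The `K`-function `ₚK_q^{ξ,η;ν}(z)`. -/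
def kFunction {p q : ℕ} (a : Fin p → ℂ) (b : Fin q → ℂ) (ξ η ν : ℂ) (z : ℂ) : ℂ :=
  ∑' n : ℕ, kFunctionTerm a b ξ η ν z n

/-- Appell's double series `F₃(α, α', β, β'; γ; x, y)`, which converges (absolutely) for
`max |x| |y| < 1` when `γ` is not a non-positive integer. -/
def appellF3Series (α α' β β' γ x y : ℂ) : ℂ :=
  ∑' k : ℕ × ℕ, poch α k.1 * poch α' k.2 * poch β k.1 * poch β' k.2 / poch γ (k.1 + k.2) *
    (x ^ k.1 / (k.1.factorial : ℂ)) * (y ^ k.2 / (k.2.factorial : ℂ))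

/-- `g` is an analytic continuation, along the segment from `(0, 0)` to `(x, y)` (parametrized as
`(s x, s y)`, `0 ≤ s ≤ 1`), of Appell's double series. By the identity theorem `g` is unique on
the segment. -/
def IsAppellF3Continuation (α α' β β' γ x y : ℂ) (g : ℂ → ℂ) : Prop :=
  AnalyticOnNhd ℂ g (Complex.ofReal '' Set.Icc (0 : ℝ) 1) ∧
    ∀ᶠ s in 𝓝 (0 : ℂ), g s = appellF3Series α α' β β' γ (s * x) (s * y)

open Classical in
/-- Appell's function `F₃(α, α', β, β'; γ; x, y)` : the principal branch, that is, the analytic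
continuation of the double series along the segment from the origin to `(x, y)`. The kernel of the
Saigo–Maeda operators needs it at points `(1 - t/x, 1 - x/t)`, `0 < t < x`, whose second
coordinate is an arbitrary negative number. -/
def appellF3 (α α' β β' γ x y : ℂ) : ℂ :=
  if h : ∃ g : ℂ → ℂ, IsAppellF3Continuation α α' β β' γ x y g then h.choose 1 else 0

/-- The integrand `(x - t)^(γ-1) t^(-α') F₃(α, α', β, β'; γ; 1 - t/x, 1 - x/t) f(t)` of the
left-sided Saigo–Maeda integral at `x`. -/
def saigoMaedaIntegrand (α α' β β' γ : ℂ) (f : ℝ → ℂ) (x t : ℝ) : ℂ :=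
  ((x - t : ℝ) : ℂ) ^ (γ - 1) * (t : ℂ) ^ (-α') *
    appellF3 α α' β β' γ ((1 - t / x : ℝ) : ℂ) ((1 - x / t : ℝ) : ℂ) * f t

/-- Saigo–Maeda's left-sided fractional integral `(I_{0+}^{α,α',β,β',γ} f)(x)`, for `x > 0` and
`Re γ > 0`. -/
def saigoMaedaIntegral (α α' β β' γ : ℂ) (f : ℝ → ℂ) (x : ℝ) : ℂ :=
  (x : ℂ) ^ (-α) / Complex.Gamma γ * ∫ t in Set.Ioo 0 x, saigoMaedaIntegrand α α' β β' γ f x t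

/-- The order `n = ⌊Re γ⌋ + 1` of the ordinary derivative in Saigo–Maeda's derivative. -/
def saigoMaedaOrder (γ : ℂ) : ℕ := ⌊γ.re⌋₊ + 1

/-- The function `I_{0+}^{-α',-α,-β'+n,-β,-γ+n} f`, `n = ⌊Re γ⌋ + 1`, whose `n`-th derivative is
Saigo–Maeda's left-sided fractional derivative of `f`. -/
def saigoMaedaPrimitive (α α' β β' γ : ℂ) (f : ℝ → ℂ) : ℝ → ℂ :=
  saigoMaedaIntegral (-α') (-α) (-β' + saigoMaedaOrder γ) (-β) (-γ + saigoMaedaOrder γ) f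

/-- Saigo–Maeda's left-sided fractional derivative `(D_{0+}^{α,α',β,β',γ} f)(x)`, `Re γ > 0`. -/
def saigoMaedaDeriv (α α' β β' γ : ℂ) (f : ℝ → ℂ) (x : ℝ) : ℂ :=
  iteratedDeriv (saigoMaedaOrder γ) (saigoMaedaPrimitive α α' β β' γ f) x

/-- The integral defining `saigoMaedaPrimitive α α' β β' γ f` exists at `x`. -/
def SaigoMaedaPrimitiveExists (α α' β β' γ : ℂ) (f : ℝ → ℂ) (x : ℝ) : Prop :=
  MeasureTheory.IntegrableOn
    (saigoMaedaIntegrand (-α') (-α) (-β' + saigoMaedaOrder γ) (-β) (-γ + saigoMaedaOrder γ) f x)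
    (Set.Ioo 0 x)

/-- Top parameters `(aᵢ, 1)₁^p, (σ, μ), (σ+α+α'+β'-γ, μ), (σ+α-β, μ), (ν, 1)`. -/
def topParams {p : ℕ} (a : Fin p → ℂ) (α α' β β' γ σ ν : ℂ) (μ : ℝ) : Fin (p + 4) → ℂ × ℂ :=
  Fin.append (fun i => (a i, 1))
    ![(σ, (μ : ℂ)), (σ + α + α' + β' - γ, (μ : ℂ)), (σ + α - β, (μ : ℂ)), (ν, 1)]

/-- Bottom parameters
`(bⱼ, 1)₁^q, (σ+α+α'-γ, μ), (σ+α+β'-γ, μ), (σ-β, μ), (η, ξ)`. -/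
def bottomParams {q : ℕ} (b : Fin q → ℂ) (α α' β β' γ σ η ξ : ℂ) (μ : ℝ) : Fin (q + 4) → ℂ × ℂ :=
  Fin.append (fun j => (b j, 1))
    ![(σ + α + α' - γ, (μ : ℂ)), (σ + α + β' - γ, (μ : ℂ)), (σ - β, (μ : ℂ)), (η, ξ)]

end

/-! The substitution `t = x u` turns the Saigo–Maeda integral into a Mellin-type integral over `(0,
1)`, so it multiplies each power of `t` by a Gamma factor; the theorem is this multiplier applied to
a power series in `t ^ μ`, followed by `n` differentiations.

The kernel needs `F₃` at `(1 - u, 1 - 1/u)`, outside the bidisc of convergence. Pfaff's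
transformation in the second variable replaces `y` by `y / (y - 1)`, which is again `1 - u`; it
supplies the analytic continuation along the segment and a convergent series in `1 - u`
(`appellF3_one_sub`). Its prefactor `u ^ A'` cancels the power of `t` in the kernel.

For `Re ρ` large, termwise Beta integrals give a double series at unit arguments, which two
applications of Gauss's theorem sum to Gammas (`tsum_doubleCoeff`, `mellin_saigoKernel_of_large`).
Analytic continuation and a boundary limit extend the formula to every `ρ` where the integral
converges absolutely and the numerator Gammas have no pole (`mellin_saigoKernel`).

Only the integral of the whole series is assumed to exist. Near `u = 0` the series is comparable to
its first non-zero term, so that term is integrable against the kernel, and all later ones are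
dominated by it (`integrableOn_term`). This justifies termwise integration and bounds the Gamma
factors uniformly. The resulting series in powers of `x` is differentiated termwise; the Pochhammer
factor produced is absorbed by the functional equation of `1 / Γ` (`saigoFactor_mul_poch`). The
`M`-series is the case `ν = 1` of the `K`-function. -/

/-! ### Pochhammer symbols and the entire function `1 / Γ`. -/

theorem poch_eq_prod (a : ℂ) (n : ℕ) : poch a n = ∏ j ∈ Finset.range n, (a + j) := by
  induction n with
  | zero => simp [poch]
  | succ n ih =>
    rw [Finset.prod_range_succ, ← ih, poch, poch, ascPochhammer_succ_eval]

theorem poch_zero (a : ℂ) : poch a 0 = 1 := by simp [poch]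

theorem poch_succ (a : ℂ) (n : ℕ) : poch a (n + 1) = poch a n * (a + n) := by
  simp [poch_eq_prod, Finset.prod_range_succ]

theorem poch_succ_left (a : ℂ) (n : ℕ) : poch a (n + 1) = a * poch (a + 1) n := by
  simp only [poch_eq_prod, Finset.prod_range_succ']
  rw [mul_comm]
  congr 1
  · simp
  · exact Finset.prod_congr rfl fun j _ => by push_cast; ring

theorem poch_add (a : ℂ) (m n : ℕ) : poch a (m + n) = poch a m * poch (a + m) n := by
  simp only [poch_eq_prod, Finset.prod_range_add]
  congr 1
  exact Finset.prod_congr rfl fun j _ => by push_cast; ring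

theorem poch_one (n : ℕ) : poch 1 n = (n.factorial : ℂ) := by
  rw [poch, ascPochhammer_eval_one]

theorem poch_ne_zero {a : ℂ} (ha : ¬ IsGammaPole a) (n : ℕ) : poch a n ≠ 0 := by
  rw [poch_eq_prod]
  refine Finset.prod_ne_zero_iff.2 fun j _ h => ha ⟨j, ?_⟩
  linear_combination h

theorem not_isGammaPole_of_re_pos {a : ℂ} (ha : 0 < a.re) : ¬ IsGammaPole a := by
  rintro ⟨m, rfl⟩
  simp only [Complex.neg_re, Complex.natCast_re] at ha
  linarith [(Nat.cast_nonneg m : (0 : ℝ) ≤ m)]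

theorem poch_ne_zero_of_re_pos {a : ℂ} (ha : 0 < a.re) (n : ℕ) : poch a n ≠ 0 :=
  poch_ne_zero (not_isGammaPole_of_re_pos ha) n

theorem Gamma_add_natCast {a : ℂ} (ha : ¬ IsGammaPole a) (n : ℕ) :
    Complex.Gamma (a + n) = poch a n * Complex.Gamma a := by
  rw [poch, ← Complex.Gamma_add_nat_div_Gamma_eq a fun k hk => ha ⟨k, hk⟩]
  rw [div_mul_cancel₀]
  exact Complex.Gamma_ne_zero fun k hk => ha ⟨k, hk⟩

theorem Gamma_ne_zero_of_not_isGammaPole {a : ℂ} (ha : ¬ IsGammaPole a) : Complex.Gamma a ≠ 0 :=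
  Complex.Gamma_ne_zero fun k hk => ha ⟨k, hk⟩

theorem Gamma_eq_zero_of_isGammaPole {a : ℂ} (ha : IsGammaPole a) : Complex.Gamma a = 0 := by
  obtain ⟨m, rfl⟩ := ha
  exact Complex.Gamma_neg_nat_eq_zero m

/-- The functional equation of the entire function `1 / Γ`, iterated. -/
theorem poch_div_Gamma_add_natCast (s : ℂ) (n : ℕ) :
    poch s n / Complex.Gamma (s + n) = 1 / Complex.Gamma s := by
  by_cases hs : IsGammaPole s
  · rw [Gamma_eq_zero_of_isGammaPole hs, div_zero]
    obtain ⟨m, rfl⟩ := hs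
    -- At `s = -m` either the Pochhammer symbol contains the factor zero, or `s + n` is still a
    -- pole, where `Complex.Gamma` takes the value `0`.
    by_cases hmn : m < n
    · rw [poch_eq_prod, Finset.prod_eq_zero (Finset.mem_range.2 hmn) (by simp), zero_div]
    · have : IsGammaPole (-(m : ℂ) + n) := by
        refine ⟨m - n, ?_⟩
        rw [Nat.cast_sub (not_lt.1 hmn)]
        ring
      rw [Gamma_eq_zero_of_isGammaPole this, div_zero]
  · rw [Gamma_add_natCast hs, div_mul_eq_div_div, div_self (poch_ne_zero hs n)]

/-! ### Growth of rising factorials. -/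

/-- The real rising factorial `x (x + 1) ⋯ (x + n - 1)`. -/
noncomputable def realPoch (x : ℝ) (n : ℕ) : ℝ := ∏ j ∈ Finset.range n, (x + j)

theorem realPoch_zero (x : ℝ) : realPoch x 0 = 1 := by simp [realPoch]

theorem realPoch_succ (x : ℝ) (n : ℕ) : realPoch x (n + 1) = realPoch x n * (x + n) := by
  simp [realPoch, Finset.prod_range_succ]

theorem realPoch_add (x : ℝ) (m n : ℕ) :
    realPoch x (m + n) = realPoch x m * realPoch (x + m) n := by
  simp only [realPoch, Finset.prod_range_add]
  congr 1
  exact Finset.prod_congr rfl fun j _ => by push_cast; ring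

theorem realPoch_one (n : ℕ) : realPoch 1 n = n.factorial := by
  induction n with
  | zero => simp [realPoch]
  | succ n ih => rw [realPoch_succ, ih, Nat.factorial_succ]; push_cast; ring

theorem ofReal_realPoch (x : ℝ) (n : ℕ) : ((realPoch x n : ℝ) : ℂ) = poch x n := by
  simp [realPoch, poch_eq_prod]

theorem realPoch_nonneg {x : ℝ} (hx : 0 ≤ x) (n : ℕ) : 0 ≤ realPoch x n :=
  Finset.prod_nonneg fun j _ => by positivity

theorem realPoch_pos {x : ℝ} (hx : 0 < x) (n : ℕ) : 0 < realPoch x n :=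
  Finset.prod_pos fun j _ => by positivity

theorem realPoch_mono {x y : ℝ} (hx : 0 ≤ x) (hxy : x ≤ y) (n : ℕ) :
    realPoch x n ≤ realPoch y n :=
  Finset.prod_le_prod (fun j _ => by positivity) fun j _ => by gcongr

theorem norm_poch_le {a : ℂ} {x : ℝ} (h : ‖a‖ ≤ x) (n : ℕ) : ‖poch a n‖ ≤ realPoch x n := by
  rw [poch_eq_prod, norm_prod]
  refine Finset.prod_le_prod (fun j _ => norm_nonneg _) fun j _ => ?_
  refine (norm_add_le _ _).trans ?_
  rw [Complex.norm_natCast]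
  gcongr

theorem realPoch_le_norm_poch {a : ℂ} {r : ℝ} (hr : 0 ≤ r) (h : r ≤ a.re) (n : ℕ) :
    realPoch r n ≤ ‖poch a n‖ := by
  rw [poch_eq_prod, norm_prod]
  refine Finset.prod_le_prod (fun j _ => by positivity) fun j _ => ?_
  refine le_trans ?_ (Complex.re_le_norm _)
  simpa using h

/-- The quotient `(s + K + n) / (s + n)` is at most `1 + K / r` always and at most `R` once `n > K /
(R - 1)`. Uniformity in `s ≥ r` is what allows `s = Re G + m` with `m` varying. -/
theorem exists_realPoch_add_le {K r R : ℝ} (hK : 0 ≤ K) (hr : 0 < r) (hR : 1 < R) :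
    ∃ C : ℝ, 0 ≤ C ∧ ∀ s, r ≤ s → ∀ n : ℕ, realPoch (s + K) n ≤ C * R ^ n * realPoch s n := by
  obtain ⟨n₀, hn₀⟩ := exists_nat_gt (K / (R - 1))
  have hR1 : 0 < R - 1 := by linarith
  have h1 : 1 ≤ 1 + K / r := by have : 0 ≤ K / r := by positivity
                                linarith
  refine ⟨(1 + K / r) ^ n₀, by positivity, fun s hs n => ?_⟩
  have hs0 : 0 < s := hr.trans_le hs
  -- Only the first `n₀` factors pay `1 + K / r`, hence the minimum.
  suffices h : realPoch (s + K) n ≤ (1 + K / r) ^ (min n n₀) * R ^ n * realPoch s n by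
    refine h.trans ?_
    have := realPoch_nonneg hs0.le n
    gcongr
    · exact min_le_right _ _
  induction n with
  | zero => simp [realPoch_zero]
  | succ n ih =>
    rw [realPoch_succ, realPoch_succ]
    have hp := realPoch_pos hs0 n
    by_cases hn : n < n₀
    · rw [min_eq_left (by omega : n ≤ n₀)] at ih
      rw [min_eq_left (by omega : n + 1 ≤ n₀)]
      have h2 : s + K + n ≤ (1 + K / r) * R * (s + n) := by
        have : s + K + n ≤ (1 + K / r) * (s + n) := by
          have : K ≤ K / r * (s + n) := by
            calc K = K / r * r := by field_simp
              _ ≤ K / r * (s + n) := by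
                gcongr
                linarith [(Nat.cast_nonneg n : (0 : ℝ) ≤ n)]
          linarith
        refine this.trans ?_
        have : (1 + K / r) * 1 ≤ (1 + K / r) * R := by gcongr
        gcongr
        linarith
      calc realPoch (s + K) n * (s + K + n)
          ≤ ((1 + K / r) ^ n * R ^ n * realPoch s n) * ((1 + K / r) * R * (s + n)) := by gcongr
        _ = _ := by ring
    · rw [min_eq_right (by omega : n₀ ≤ n)] at ih
      rw [min_eq_right (by omega : n₀ ≤ n + 1)]
      have h2 : s + K + n ≤ R * (s + n) := by
        have h3 : (n₀ : ℝ) ≤ n := by exact_mod_cast not_lt.1 hn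
        have h4 : K < n₀ * (R - 1) := by rwa [div_lt_iff₀ hR1] at hn₀
        nlinarith
      calc realPoch (s + K) n * (s + K + n)
          ≤ ((1 + K / r) ^ n₀ * R ^ n * realPoch s n) * (R * (s + n)) := by gcongr
        _ = _ := by ring

/-! ### Geometric bounds for double hypergeometric series. -/

/-- The coefficients of a double series `∑ (A)_m (A')_n (B)_m (D m)_n / ((G)_{m+n} m! n!) x^m y^n`. -/
noncomputable def doubleCoeff (A A' B : ℂ) (D : ℕ → ℂ) (G : ℂ) (k : ℕ × ℕ) : ℂ :=
  poch A k.1 * poch A' k.2 * poch B k.1 * poch (D k.1) k.2 / poch G (k.1 + k.2) /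
    ((k.1.factorial : ℂ) * (k.2.factorial : ℂ))

/-- `A` and `A'` are weighed against the factorials, `B` and `D m` against the two blocks of
`(G)_{m+n} = (G)_m (G+m)_n`; the growth of `D m` is matched by the shift `G + m`. Each index takes
part in two comparisons costing `√R` each. Constant `D` is Appell's series, `D m = G - B' + m` its
Pfaff transform. -/
theorem exists_norm_doubleCoeff_le (A A' B : ℂ) {D : ℕ → ℂ} {G : ℂ} {K : ℝ} (hK : 0 ≤ K)
    (hG : 0 < G.re) (hD : ∀ m, ‖D m‖ ≤ K + m) {R : ℝ} (hR : 1 < R) :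
    ∃ C : ℝ, 0 ≤ C ∧ ∀ k, ‖doubleCoeff A A' B D G k‖ ≤ C * R ^ (k.1 + k.2) := by
  have hS : 1 < √R := by rw [Real.lt_sqrt (by norm_num)]; simpa using hR
  have hSR : √R * √R = R := Real.mul_self_sqrt (by linarith)
  obtain ⟨C₁, hC₁, h₁⟩ := exists_realPoch_add_le (norm_nonneg A) one_pos hS
  obtain ⟨C₂, hC₂, h₂⟩ := exists_realPoch_add_le (norm_nonneg A') one_pos hS
  obtain ⟨C₃, hC₃, h₃⟩ := exists_realPoch_add_le (norm_nonneg B) hG hS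
  obtain ⟨C₄, hC₄, h₄⟩ := exists_realPoch_add_le hK hG hS
  refine ⟨C₁ * C₂ * C₃ * C₄, by positivity, fun ⟨m, n⟩ => ?_⟩
  have hm := h₁ 1 le_rfl m
  have hn := h₂ 1 le_rfl n
  have hB := h₃ _ le_rfl m
  have hD' := h₄ (G.re + m) (by linarith [(Nat.cast_nonneg m : (0 : ℝ) ≤ m)]) n
  rw [realPoch_one] at hm hn
  have e₁ : ‖poch A m‖ ≤ C₁ * √R ^ m * m.factorial :=
    (norm_poch_le (by linarith) m).trans hm
  have e₂ : ‖poch A' n‖ ≤ C₂ * √R ^ n * n.factorial :=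
    (norm_poch_le (by linarith) n).trans hn
  have e₃ : ‖poch B m‖ ≤ C₃ * √R ^ m * realPoch G.re m :=
    (norm_poch_le (by linarith) m).trans hB
  have e₄ : ‖poch (D m) n‖ ≤ C₄ * √R ^ n * realPoch (G.re + m) n :=
    (norm_poch_le (by linarith [hD m]) n).trans hD'
  have e₅ : realPoch G.re m * realPoch (G.re + m) n ≤ ‖poch G (m + n)‖ := by
    rw [← realPoch_add]
    exact realPoch_le_norm_poch hG.le le_rfl _
  have p₁ := realPoch_pos hG m
  have p₂ := realPoch_pos (by positivity : 0 < G.re + m) n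
  have f₁ : (0 : ℝ) < m.factorial := by positivity
  have f₂ : (0 : ℝ) < n.factorial := by positivity
  simp only [doubleCoeff, norm_div, norm_mul, Complex.norm_natCast]
  rw [div_div, div_le_iff₀ (mul_pos ((mul_pos p₁ p₂).trans_le e₅) (mul_pos f₁ f₂))]
  calc ‖poch A m‖ * ‖poch A' n‖ * ‖poch B m‖ * ‖poch (D m) n‖
      ≤ (C₁ * √R ^ m * m.factorial) * (C₂ * √R ^ n * n.factorial) *
        (C₃ * √R ^ m * realPoch G.re m) * (C₄ * √R ^ n * realPoch (G.re + m) n) := by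
        gcongr
    _ = C₁ * C₂ * C₃ * C₄ * (√R * √R) ^ (m + n) *
        ((realPoch G.re m * realPoch (G.re + m) n) * (m.factorial * n.factorial)) := by
        rw [mul_pow, pow_add]; ring
    _ ≤ _ := by
        rw [hSR]
        gcongr

theorem summable_pow_fst_mul_pow_snd {x y : ℝ} (hx : 0 ≤ x) (hx1 : x < 1) (hy : 0 ≤ y)
    (hy1 : y < 1) : Summable fun k : ℕ × ℕ => x ^ k.1 * y ^ k.2 :=
  (summable_geometric_of_lt_one hx hx1).mul_of_nonneg (summable_geometric_of_lt_one hy hy1)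
    (fun _ => by positivity) fun _ => by positivity

theorem summable_norm_doubleCoeff_mul_pow (A A' B : ℂ) {D : ℕ → ℂ} {G : ℂ} {K : ℝ} (hK : 0 ≤ K)
    (hG : 0 < G.re) (hD : ∀ m, ‖D m‖ ≤ K + m) {q : ℝ} (hq : 0 ≤ q) (hq1 : q < 1) :
    Summable fun k : ℕ × ℕ => ‖doubleCoeff A A' B D G k‖ * q ^ (k.1 + k.2) := by
  obtain ⟨R, hR, hRq⟩ : ∃ R : ℝ, 1 < R ∧ R * q < 1 := by
    rcases hq.eq_or_lt with rfl | hq0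
    · exact ⟨2, by norm_num, by norm_num⟩
    · obtain ⟨R, h1, h2⟩ := exists_between ((one_lt_div hq0).2 hq1)
      exact ⟨R, h1, (lt_div_iff₀ hq0).1 h2⟩
  obtain ⟨C, hC, h⟩ := exists_norm_doubleCoeff_le A A' B hK hG hD hR
  have hRq0 : 0 ≤ R * q := by positivity
  refine Summable.of_nonneg_of_le (fun k => by positivity) (fun k => ?_)
    ((summable_pow_fst_mul_pow_snd hRq0 hRq hRq0 hRq).mul_left C)
  calc _ ≤ C * R ^ (k.1 + k.2) * q ^ (k.1 + k.2) := by gcongr; exact h k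
    _ = _ := by rw [← pow_add, mul_pow]; ring

/-! ### Chu–Vandermonde and Pfaff's transformation. -/

/-- This is `₂F₁(-N, c - b; c; 1) = (b)_N / (c)_N` cleared of denominators. Pascal's rule splits the
sum into the previous case at `c` and at `c + 1`, and `(c + N) - (c - b) = b + N`. -/
theorem chu_vandermonde (N : ℕ) (b c : ℂ) :
    ∑ ij ∈ Finset.HasAntidiagonal.antidiagonal N,
      (N.choose ij.1 : ℂ) * ((-1) ^ ij.1 * poch (c - b) ij.1 * poch (c + ij.1) ij.2) = poch b N := by
  induction N generalizing c with
  | zero => simp [poch_zero]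
  | succ N ih =>
    rw [Finset.sum_antidiagonal_choose_succ_mul
      (fun i j => (-1) ^ i * poch (c - b) i * poch (c + i) j)]
    have h1 : ∑ ij ∈ Finset.HasAntidiagonal.antidiagonal N, (N.choose ij.1 : ℂ) *
        ((-1) ^ ij.1 * poch (c - b) ij.1 * poch (c + ij.1) (ij.2 + 1)) =
        (c + N) * poch b N := by
      rw [← ih c, Finset.mul_sum]
      refine Finset.sum_congr rfl fun ij hij => ?_
      rw [poch_succ, ← Finset.HasAntidiagonal.mem_antidiagonal.1 hij]
      push_cast
      ring
    have h2 : ∑ ij ∈ Finset.HasAntidiagonal.antidiagonal N, (N.choose ij.2 : ℂ) *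
        ((-1) ^ (ij.1 + 1) * poch (c - b) (ij.1 + 1) * poch (c + (ij.1 + 1 : ℕ)) ij.2) =
        -(c - b) * poch b N := by
      rw [← ih (c + 1), Finset.mul_sum]
      refine Finset.sum_congr rfl fun ij hij => ?_
      rw [poch_succ_left, Nat.choose_symm_of_eq_add (Finset.HasAntidiagonal.mem_antidiagonal.1 hij).symm]
      rw [show c - b + 1 = c + 1 - b by ring, show c + ((ij.1 + 1 : ℕ) : ℂ) = c + 1 + ij.1 by
        push_cast; ring]
      ring
    rw [h1, h2, poch_succ]
    ring

theorem tsum_prod_eq_tsum_sum_antidiagonal {f : ℕ × ℕ → ℂ} (hf : Summable f) :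
    ∑' k, f k = ∑' N, ∑ k ∈ Finset.HasAntidiagonal.antidiagonal N, f k := by
  have h : Summable (f ∘ Finset.HasAntidiagonal.sigmaAntidiagonalEquivProd) :=
    Finset.HasAntidiagonal.sigmaAntidiagonalEquivProd.summable_iff.2 hf
  rw [← Finset.HasAntidiagonal.sigmaAntidiagonalEquivProd.tsum_eq f]
  refine (Summable.tsum_sigma' (fun _ => (hasSum_fintype _).summable) h).trans
    (tsum_congr fun N => ?_)
  rw [tsum_fintype]
  exact Finset.sum_attach (Finset.HasAntidiagonal.antidiagonal N) f

theorem ringChoose_eq_poch_div (a : ℂ) (n : ℕ) :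
    Ring.choose (a + n - 1) n = poch a n / (n.factorial : ℂ) := by
  rw [eq_div_iff (by exact_mod_cast n.factorial_ne_zero), Ring.choose]
  have := Ring.factorial_nsmul_multichoose_eq_ascPochhammer a n
  rw [Polynomial.ascPochhammer_smeval_eq_eval, nsmul_eq_mul] at this
  rw [poch, ← this, show a + n - 1 - n + 1 = a by ring, mul_comm]

theorem hasSum_poch_div_factorial_mul_pow (a : ℂ) {y : ℂ} (hy : ‖y‖ < 1) :
    HasSum (fun k : ℕ => poch a k / (k.factorial : ℂ) * y ^ k) ((1 - y) ^ (-a)) := by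
  have h := (Complex.one_div_one_sub_cpow_hasFPowerSeriesOnBall_zero a).hasSum (y := y)
    (by rwa [Metric.mem_eball, edist_zero_right, ← ofReal_norm, ENNReal.ofReal_lt_one])
  simp only [FormalMultilinearSeries.ofScalars_apply_eq, ringChoose_eq_poch_div] at h
  simpa [Complex.cpow_neg, smul_eq_mul] using h

theorem one_sub_ne_zero_of_norm_lt_one {y : ℂ} (hy : ‖y‖ < 1) : 1 - y ≠ 0 := by
  intro h
  rw [← sub_eq_zero.1 h] at hy
  simp at hy

/-- Allows the rearrangement in Pfaff's transformation. Comparing `(a)_{n+k}` with `n! k!` costs a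
binomial coefficient, at most `2 ^ (n + k)`, which a small disc absorbs; only a neighbourhood of the
origin is needed. -/
theorem summable_pfaff (a b c : ℂ) (hc : 0 < c.re) {y : ℂ} (hy : ‖y‖ ≤ 1 / 4) :
    Summable fun k : ℕ × ℕ => poch a k.1 * poch (c - b) k.1 / (poch c k.1 * k.1.factorial) *
      (-y) ^ k.1 * (poch (a + k.1) k.2 / (k.2.factorial : ℂ) * y ^ k.2) := by
  -- With `R = 5/4` the final ratio is `R · R · 2 · 1/4 = 25/32 < 1`.
  obtain ⟨C₁, hC₁, h₁⟩ := exists_realPoch_add_le (norm_nonneg a) one_pos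
    (by norm_num : (1 : ℝ) < 5 / 4)
  obtain ⟨C₂, hC₂, h₂⟩ := exists_realPoch_add_le (norm_nonneg (c - b)) hc
    (by norm_num : (1 : ℝ) < 5 / 4)
  refine Summable.of_norm_bounded (g := fun k : ℕ × ℕ => C₁ * C₂ *
      ((25 / 32 : ℝ) ^ k.1 * (25 / 32 : ℝ) ^ k.2))
    ((summable_pow_fst_mul_pow_snd (by norm_num) (by norm_num) (by norm_num)
      (by norm_num)).mul_left _) fun ⟨n, k⟩ => ?_
  have e₁ : ‖poch a n * poch (a + n) k‖ ≤ C₁ * (5 / 4) ^ (n + k) * (2 ^ (n + k) *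
      (n.factorial * k.factorial)) := by
    rw [← poch_add]
    refine (norm_poch_le (by linarith) _).trans ((h₁ 1 le_rfl (n + k)).trans ?_)
    rw [realPoch_one]
    gcongr
    rw [← Nat.add_choose_mul_factorial_mul_factorial n k]
    push_cast
    rw [mul_assoc]
    gcongr
    exact_mod_cast Nat.choose_le_two_pow _ _
  have e₂ : ‖poch (c - b) n‖ ≤ C₂ * (5 / 4) ^ n * ‖poch c n‖ := by
    refine (norm_poch_le (by linarith) _).trans ((h₂ _ le_rfl n).trans ?_)
    gcongr
    exact realPoch_le_norm_poch hc.le le_rfl _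
  have p : 0 < ‖poch c n‖ := norm_pos_iff.2 (poch_ne_zero_of_re_pos hc n)
  have f₁ : (0 : ℝ) < n.factorial := by positivity
  have f₂ : (0 : ℝ) < k.factorial := by positivity
  calc _ = ‖poch a n * poch (a + n) k‖ * ‖poch (c - b) n‖ * ‖y‖ ^ (n + k) /
        (‖poch c n‖ * (n.factorial * k.factorial)) := by
        simp only [norm_mul, norm_div, norm_pow, norm_neg, Complex.norm_natCast, pow_add]
        field_simp
    _ ≤ (C₁ * (5 / 4) ^ (n + k) * (2 ^ (n + k) * (n.factorial * k.factorial))) *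
        (C₂ * (5 / 4) ^ (n + k) * ‖poch c n‖) * (1 / 4) ^ (n + k) /
        (‖poch c n‖ * (n.factorial * k.factorial)) := by
        gcongr
        refine e₂.trans ?_
        gcongr
        · norm_num
        · omega
    _ = C₁ * C₂ * ((5 / 4) * (5 / 4) * 2 * (1 / 4)) ^ (n + k) := by
        simp only [mul_pow]
        field_simp
    _ = _ := by rw [pow_add]; norm_num

/-- **Pfaff's transformation** of the Gauss series, near the origin. -/
theorem pfaff_transformation (a b c : ℂ) (hc : 0 < c.re) {y : ℂ} (hy : ‖y‖ ≤ 1 / 4) :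
    ∑' n : ℕ, poch a n * poch b n / (poch c n * n.factorial) * y ^ n =
      (1 - y) ^ (-a) *
        ∑' n : ℕ, poch a n * poch (c - b) n / (poch c n * n.factorial) * (y / (y - 1)) ^ n := by
  have hy1 : ‖y‖ < 1 := by linarith
  have hs := summable_pfaff a b c hc hy
  have hne := one_sub_ne_zero_of_norm_lt_one hy1
  -- `(1 - y) ^ (-a) (y / (y - 1)) ^ n = (-y) ^ n (1 - y) ^ (-(a + n))`, expanded by the binomial
  -- series.
  have e1 : ∀ n : ℕ, (1 - y) ^ (-a) * (poch a n * poch (c - b) n / (poch c n * n.factorial) *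
      (y / (y - 1)) ^ n) = ∑' k : ℕ, poch a n * poch (c - b) n / (poch c n * n.factorial) *
      (-y) ^ n * (poch (a + n) k / (k.factorial : ℂ) * y ^ k) := by
    intro n
    rw [tsum_mul_left, (hasSum_poch_div_factorial_mul_pow (a + n) hy1).tsum_eq,
      show y / (y - 1) = (-y) / (1 - y) by rw [← neg_sub y 1, neg_div_neg_eq], div_pow,
      neg_add, Complex.cpow_add _ _ hne, Complex.cpow_neg _ (n : ℂ), Complex.cpow_natCast]
    ring
  rw [← tsum_mul_left, tsum_congr e1, ← hs.tsum_prod,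
    tsum_prod_eq_tsum_sum_antidiagonal hs]
  refine tsum_congr fun N => ?_
  -- The coefficients of `y ^ N` agree by Chu–Vandermonde.
  rw [← chu_vandermonde N b c, Finset.mul_sum, Finset.sum_div, Finset.sum_mul]
  refine Finset.sum_congr rfl fun ⟨n, k⟩ hnk => ?_
  obtain rfl : n + k = N := Finset.HasAntidiagonal.mem_antidiagonal.1 hnk
  have h1 := poch_ne_zero_of_re_pos hc n
  have h2 : poch (c + n) k ≠ 0 := poch_ne_zero_of_re_pos
    (by simpa using by positivity) k
  have h3 : ((n + k).factorial : ℂ) = (n + k).choose n * (n.factorial * k.factorial) := by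
    rw [← Nat.add_choose_mul_factorial_mul_factorial n k, Nat.choose_symm_add]
    push_cast
    ring
  have h4 : ((n + k).choose n : ℂ) ≠ 0 := by
    exact_mod_cast (Nat.choose_pos (by omega)).ne'
  have h5 : (n.factorial : ℂ) ≠ 0 := by exact_mod_cast n.factorial_ne_zero
  have h6 : (k.factorial : ℂ) ≠ 0 := by exact_mod_cast k.factorial_ne_zero
  simp only
  rw [h3, poch_add a, poch_add c, neg_pow y n, pow_add]
  field_simp

theorem summable_doubleCoeff_mul_pow (A A' B : ℂ) {D : ℕ → ℂ} {G : ℂ} {K : ℝ} (hK : 0 ≤ K)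
    (hG : 0 < G.re) (hD : ∀ m, ‖D m‖ ≤ K + m) {x y : ℂ} (hx : ‖x‖ < 1) (hy : ‖y‖ < 1) :
    Summable fun k : ℕ × ℕ => doubleCoeff A A' B D G k * x ^ k.1 * y ^ k.2 := by
  refine Summable.of_norm_bounded (summable_norm_doubleCoeff_mul_pow A A' B hK hG hD
    (q := max ‖x‖ ‖y‖) (by positivity) (max_lt hx hy)) fun k => ?_
  rw [norm_mul, norm_mul, norm_pow, norm_pow, pow_add, mul_assoc]
  gcongr
  · exact le_max_left _ _
  · exact le_max_right _ _

/-! ### Continuation of Appell's `F₃` to the points of the kernel. -/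

theorem doubleCoeff_eq (A A' B : ℂ) (D : ℕ → ℂ) (G : ℂ) (m n : ℕ) :
    doubleCoeff A A' B D G (m, n) = poch A m * poch B m / (poch G m * m.factorial) *
      (poch A' n * poch (D m) n / (poch (G + m) n * n.factorial)) := by
  simp only [doubleCoeff, poch_add, div_div, div_mul_div_comm]
  congr 1 <;> ring

/-- The sum of the double series with coefficients `(A)_m (A')_n (B)_m (G-B'+m)_n / ((G)_{m+n} m! n!)`. -/
noncomputable def pfaffSeries (A A' B B' G x y : ℂ) : ℂ :=
  ∑' k : ℕ × ℕ, doubleCoeff A A' B (fun m => G - B' + m) G k * x ^ k.1 * y ^ k.2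

theorem norm_sub_add_natCast_le (G B' : ℂ) (m : ℕ) : ‖G - B' + m‖ ≤ ‖G - B'‖ + m := by
  simpa using norm_add_le (G - B') (m : ℂ)

/-- For fixed `m` the inner sum is a Gauss series with lower parameter `G + m`; Pfaff's
transformation replaces `B'` by `G + m - B'`, whence the dependence on `m`. -/
theorem appellF3Series_eq_pfaffSeries (A A' B B' : ℂ) {G x y : ℂ} (hG : 0 < G.re)
    (hx : ‖x‖ < 1) (hy : ‖y‖ ≤ 1 / 4) :
    appellF3Series A A' B B' G x y =
      (1 - y) ^ (-A') * pfaffSeries A A' B B' G x (y / (y - 1)) := by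
  have hy1 : ‖y‖ < 1 := by linarith
  have hy2 : ‖y / (y - 1)‖ < 1 := by
    have h : 3 / 4 ≤ ‖y - 1‖ := by
      have := norm_sub_norm_le 1 y
      rw [norm_one, norm_sub_rev] at this
      linarith
    rw [norm_div, div_lt_one (by linarith)]
    linarith
  have h1 : appellF3Series A A' B B' G x y =
      ∑' k : ℕ × ℕ, doubleCoeff A A' B (fun _ => B') G k * x ^ k.1 * y ^ k.2 := by
    refine tsum_congr fun k => ?_
    rw [doubleCoeff]
    field_simp
  rw [h1, pfaffSeries, (summable_doubleCoeff_mul_pow A A' B (norm_nonneg B') hG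
    (fun m => by simp) hx hy1).tsum_prod, (summable_doubleCoeff_mul_pow A A' B
    (norm_nonneg (G - B')) hG (norm_sub_add_natCast_le G B') hx hy2).tsum_prod, ← tsum_mul_left]
  refine tsum_congr fun m => ?_
  have hGm : 0 < (G + m).re := by simpa using by positivity
  calc _ = poch A m * poch B m / (poch G m * m.factorial) * x ^ m *
        ∑' n : ℕ, poch A' n * poch B' n / (poch (G + m) n * n.factorial) * y ^ n := by
        rw [← tsum_mul_left]
        refine tsum_congr fun n => ?_
        rw [doubleCoeff_eq]
        ring
    _ = _ := by
        rw [pfaff_transformation A' B' (G + m) hGm hy, ← tsum_mul_left, ← tsum_mul_left,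
          ← tsum_mul_left]
        refine tsum_congr fun n => ?_
        rw [doubleCoeff_eq, show G + m - B' = G - B' + m by ring]
        ring

theorem differentiableOn_pfaffSeries (A A' B B' : ℂ) {G : ℂ} (hG : 0 < G.re) {q : ℝ}
    (hq : 0 ≤ q) (hq1 : q < 1) {U : Set ℂ} (hU : IsOpen U) {X Y : ℂ → ℂ}
    (hX : DifferentiableOn ℂ X U) (hY : DifferentiableOn ℂ Y U) (hXq : ∀ s ∈ U, ‖X s‖ ≤ q)
    (hYq : ∀ s ∈ U, ‖Y s‖ ≤ q) :
    DifferentiableOn ℂ (fun s => pfaffSeries A A' B B' G (X s) (Y s)) U := by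
  refine Complex.differentiableOn_tsum_of_summable_norm
    (summable_norm_doubleCoeff_mul_pow A A' B (norm_nonneg (G - B')) hG
      (norm_sub_add_natCast_le G B') hq hq1) (fun k => ?_) hU fun k s hs => ?_
  · exact ((hX.pow _).const_mul _).mul (hY.pow _)
  · rw [norm_mul, norm_mul, norm_pow, norm_pow, pow_add, mul_assoc]
    gcongr
    · exact hXq s hs
    · exact hYq s hs

/-- The kernel value of Appell's function in the Saigo–Maeda operators, as a power series
in `1 - u`. -/
theorem appellF3_one_sub (A A' B B' : ℂ) {G : ℂ} (hG : 0 < G.re) {u : ℝ} (hu : u ∈ Set.Ioo 0 1) :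
    appellF3 A A' B B' G ((1 - u : ℝ) : ℂ) ((1 - 1 / u : ℝ) : ℂ) =
      (u : ℂ) ^ A' * pfaffSeries A A' B B' G ((1 - u : ℝ) : ℂ) ((1 - u : ℝ) : ℂ) := by
  obtain ⟨hu0, hu1⟩ := hu
  obtain ⟨q, hq, hq1⟩ := exists_between (by linarith : 1 - u < 1)
  set x : ℝ := 1 - u with hx
  set y : ℝ := 1 - 1 / u with hy
  have hy0 : y < 0 := by
    rw [hy, sub_neg, lt_div_iff₀ hu0]; linarith
  -- Equivalent to `|y| / (1 + |y|) < q`, the worst case on the segment of `|s y / (s y - 1)| < q`.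
  have hyq : -y * (1 - q) < q := by
    have : -y = (1 - u) / u := by rw [hy]; field_simp; ring
    rw [this, div_mul_eq_mul_div, div_lt_iff₀ hu0]
    nlinarith
  -- On `U` both arguments of the transformed series have norm below `q < 1`, and `1 - s y` avoids
  -- the cut of the principal power.
  let U : Set ℂ := {s | ‖s * x‖ < q} ∩ {s | ‖s * y‖ < q * ‖1 - s * y‖} ∩ {s | 0 < (1 - s * y).re}
  have hU : IsOpen U := by
    refine ((isOpen_lt ?_ ?_).inter (isOpen_lt ?_ ?_)).inter (isOpen_lt ?_ ?_) <;> fun_prop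
  have hsub : Complex.ofReal '' Set.Icc (0 : ℝ) 1 ⊆ U := by
    rintro _ ⟨s, ⟨hs0, hs1⟩, rfl⟩
    have hsy : s * y ≤ 0 := mul_nonpos_of_nonneg_of_nonpos hs0 hy0.le
    refine ⟨⟨?_, ?_⟩, ?_⟩
    · simp only [Set.mem_ofPred_eq]
      rw [← Complex.ofReal_mul, Complex.norm_real, Real.norm_eq_abs, abs_of_nonneg (by nlinarith)]
      nlinarith
    · simp only [Set.mem_ofPred_eq]
      rw [← Complex.ofReal_mul, ← Complex.ofReal_one, ← Complex.ofReal_sub, Complex.norm_real,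
        Complex.norm_real, Real.norm_eq_abs, Real.norm_eq_abs, abs_of_nonpos hsy,
        abs_of_nonneg (by linarith)]
      nlinarith
    · simp only [Set.mem_ofPred_eq]
      rw [← Complex.ofReal_mul, ← Complex.ofReal_one, ← Complex.ofReal_sub, Complex.ofReal_re]
      linarith
  have hne : ∀ s ∈ U, 1 - s * (y : ℂ) ≠ 0 := fun s hs h => by
    have := hs.2
    rw [Set.mem_ofPred_eq, h] at this
    simp at this
  let g : ℂ → ℂ := fun s => (1 - s * y) ^ (-A') *
    pfaffSeries A A' B B' G (s * x) (s * y / (s * y - 1))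
  have hgd : DifferentiableOn ℂ g U := by
    refine DifferentiableOn.mul ?_ ?_
    · refine DifferentiableOn.cpow (by fun_prop) (by fun_prop) fun s hs => ?_
      exact Or.inl hs.2
    · refine differentiableOn_pfaffSeries A A' B B' hG (by linarith) hq1 hU (by fun_prop) ?_
        (fun s hs => hs.1.1.le) fun s hs => ?_
      · refine DifferentiableOn.div (by fun_prop) (by fun_prop) fun s hs h => hne s hs ?_
        linear_combination -h
      · rw [norm_div, norm_sub_rev, div_le_iff₀ (norm_pos_iff.2 (hne s hs))]
        exact hs.1.2.le
  have hga : AnalyticOnNhd ℂ g (Complex.ofReal '' Set.Icc (0 : ℝ) 1) :=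
    (hgd.analyticOnNhd hU).mono hsub
  have hg0 : ∀ᶠ s in 𝓝 (0 : ℂ), g s = appellF3Series A A' B B' G (s * x) (s * y) := by
    have h1 : ∀ᶠ s in 𝓝 (0 : ℂ), ‖s * (x : ℂ)‖ < 1 :=
      ContinuousAt.eventually_lt (by fun_prop) (by fun_prop) (by simp)
    have h2 : ∀ᶠ s in 𝓝 (0 : ℂ), ‖s * (y : ℂ)‖ < 1 / 4 :=
      ContinuousAt.eventually_lt (by fun_prop) (by fun_prop) (by simp)
    filter_upwards [h1, h2] with s hs1 hs2
    rw [appellF3Series_eq_pfaffSeries A A' B B' hG hs1 hs2.le]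
  have hex : ∃ g : ℂ → ℂ, IsAppellF3Continuation A A' B B' G x y g := ⟨g, hga, hg0⟩
  rw [appellF3, dif_pos hex]
  obtain ⟨ha, h0⟩ := hex.choose_spec
  have hpre : IsPreconnected (Complex.ofReal '' Set.Icc (0 : ℝ) 1) :=
    isPreconnected_Icc.image _ Complex.continuous_ofReal.continuousOn
  -- By the identity theorem the continuation picked by choice agrees with `g` on the segment, in
  -- particular at its endpoint.
  have heq := ha.eqOn_of_preconnected_of_eventuallyEq hga hpre (z₀ := 0) ⟨0, by simp, by simp⟩
    (by filter_upwards [h0, hg0] with s h1 h2 using h1.trans h2.symm)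
  rw [heq ⟨1, by simp, by simp⟩]
  have hu' : (u : ℂ) ≠ 0 := by exact_mod_cast hu0.ne'
  have h1y : 1 - (y : ℂ) = (u : ℂ)⁻¹ := by rw [hy]; push_cast; field_simp; ring
  have h2y : (y : ℂ) / (y - 1) = x := by
    rw [show (y : ℂ) = 1 - (u : ℂ)⁻¹ by rw [← h1y]; ring, hx]; push_cast; field_simp; ring
  simp only [g, one_mul, h1y, h2y]
  rw [Complex.cpow_neg, Complex.inv_cpow, inv_inv]
  rw [Complex.arg_ofReal_of_nonneg hu0.le]
  exact Real.pi_pos.ne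

/-! ### Gauss's summation theorem. -/

/-- The terms of the Gauss series `₂F₁(a, b; c; 1)`. -/
noncomputable def gaussTerm (a b c : ℂ) (n : ℕ) : ℂ :=
  poch a n * poch b n / (poch c n * n.factorial)

/-- The terms of the Gauss series `₂F₁(x, y; r; 1)` with real parameters. -/
noncomputable def realGaussTerm (x y r : ℝ) (n : ℕ) : ℝ :=
  realPoch x n * realPoch y n / (realPoch r n * n.factorial)

theorem ofReal_realGaussTerm (x y r : ℝ) (n : ℕ) :
    ((realGaussTerm x y r n : ℝ) : ℂ) = gaussTerm x y r n := by
  simp [realGaussTerm, gaussTerm, ofReal_realPoch]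

theorem realGaussTerm_nonneg {x y r : ℝ} (hx : 0 ≤ x) (hy : 0 ≤ y) (hr : 0 < r) (n : ℕ) :
    0 ≤ realGaussTerm x y r n := by
  have := realPoch_nonneg hx n
  have := realPoch_nonneg hy n
  have := realPoch_pos hr n
  unfold realGaussTerm
  positivity

theorem realGaussTerm_telescope {x y r : ℝ} (hr : 0 < r) (n : ℕ) :
    realGaussTerm x y r n * (n * (r - x - y) - x * y) =
      (r + n) * (n * realGaussTerm x y r n - (n + 1 : ℕ) * realGaussTerm x y r (n + 1)) := by
  have := (realPoch_pos hr n).ne'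
  have : (n.factorial : ℝ) ≠ 0 := by positivity
  have : r + n ≠ 0 := by positivity
  simp only [realGaussTerm, realPoch_succ, Nat.factorial_succ]
  push_cast
  field_simp
  ring

/-- Raabe's test: for large `n` the term `t n` is at most a constant times `n t n - (n + 1) t (n +
1)`, which telescopes. -/
theorem summable_realGaussTerm {x y r : ℝ} (hx : 0 ≤ x) (hy : 0 ≤ y) (hr : x + y < r) :
    Summable (realGaussTerm x y r) := by
  have hr0 : 0 < r := by linarith
  -- Half of the excess; the other half absorbs `x y + δ r` for `n ≥ n₀`.
  set δ := (r - x - y) / 2 with hδ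
  have hδ0 : 0 < δ := by rw [hδ]; linarith
  obtain ⟨n₀, hn₀⟩ := exists_nat_gt ((x * y + δ * r) / δ)
  rw [div_lt_iff₀ hδ0] at hn₀
  have hstep : ∀ n, n₀ ≤ n → δ * realGaussTerm x y r n ≤
      n * realGaussTerm x y r n - (n + 1 : ℕ) * realGaussTerm x y r (n + 1) := by
    intro n hn
    have hn' : (n₀ : ℝ) ≤ n := by exact_mod_cast hn
    have h0 := realGaussTerm_nonneg hx hy hr0 n
    have hrn : 0 < r + n := by positivity
    refine le_of_mul_le_mul_left ?_ hrn
    rw [← realGaussTerm_telescope hr0]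
    have : δ * (r + n) ≤ n * (r - x - y) - x * y := by
      have : r - x - y = 2 * δ := by rw [hδ]; ring
      rw [this]
      nlinarith
    nlinarith
  rw [← summable_nat_add_iff n₀]
  refine summable_of_sum_range_le (c := n₀ * realGaussTerm x y r n₀ / δ)
    (fun n => realGaussTerm_nonneg hx hy hr0 _) fun N => ?_
  rw [le_div_iff₀ hδ0, mul_comm, Finset.mul_sum]
  calc _ ≤ ∑ i ∈ Finset.range N, (((i + n₀ : ℕ) : ℝ) * realGaussTerm x y r (i + n₀) -
        ((i + 1 + n₀ : ℕ) : ℝ) * realGaussTerm x y r (i + 1 + n₀)) := by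
        refine Finset.sum_le_sum fun i _ => ?_
        rw [show i + 1 + n₀ = i + n₀ + 1 by ring]
        exact hstep _ (by omega)
    _ = _ := Finset.sum_range_sub' (fun i => ((i + n₀ : ℕ) : ℝ) * realGaussTerm x y r (i + n₀)) N
    _ ≤ _ := by
        have := realGaussTerm_nonneg hx hy hr0 (N + n₀)
        rw [zero_add]
        have : 0 ≤ ((N + n₀ : ℕ) : ℝ) * realGaussTerm x y r (N + n₀) := by positivity
        linarith

/-- Multiplication by `r - 1 + n` lowers the bottom parameter to `r - 1`, where the series still
converges. -/
theorem tendsto_natCast_mul_realGaussTerm {x y r : ℝ} (hx : 0 ≤ x) (hy : 0 ≤ y)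
    (hr : x + y + 1 < r) :
    Filter.Tendsto (fun n : ℕ => n * realGaussTerm x y r n) Filter.atTop (𝓝 0) := by
  have hs := (summable_realGaussTerm hx hy (by linarith : x + y < r - 1)).tendsto_atTop_zero
  have hr0 : 0 < r - 1 := by linarith
  refine squeeze_zero (fun n => ?_) (fun n => ?_) (by simpa using hs.const_mul (r - 1))
  · have := realGaussTerm_nonneg hx hy (by linarith : 0 < r) n
    positivity
  · have hp : realPoch r n * (r - 1) = realPoch (r - 1) n * (r - 1 + n) := by
      rw [← realPoch_succ, add_comm n 1, realPoch_add]
      simp [realPoch_succ, realPoch_zero, mul_comm]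
    have h0 := realGaussTerm_nonneg hx hy hr0 n
    have hrn : realPoch (r - 1) n ≠ 0 := (realPoch_pos hr0 n).ne'
    have hrn' : realPoch r n ≠ 0 := (realPoch_pos (by linarith) n).ne'
    have : (n.factorial : ℝ) ≠ 0 := by positivity
    have key : (r - 1 + n) * realGaussTerm x y r n = (r - 1) * realGaussTerm x y (r - 1) n := by
      simp only [realGaussTerm]
      field_simp
      linear_combination -(realPoch x n * realPoch y n) * hp
    have := realGaussTerm_nonneg hx hy (by linarith : 0 < r) n
    nlinarith

theorem norm_gaussTerm_le {a b c : ℂ} {x y r : ℝ} (ha : ‖a‖ ≤ x) (hb : ‖b‖ ≤ y) (hr : 0 < r)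
    (hc : r ≤ c.re) (n : ℕ) : ‖gaussTerm a b c n‖ ≤ realGaussTerm x y r n := by
  simp only [gaussTerm, realGaussTerm, norm_div, norm_mul, Complex.norm_natCast]
  have := realPoch_pos hr n
  have := realPoch_nonneg ((norm_nonneg _).trans ha) n
  have := realPoch_nonneg ((norm_nonneg _).trans hb) n
  gcongr
  · exact norm_poch_le ha n
  · exact norm_poch_le hb n
  · exact realPoch_le_norm_poch hr.le hc n

theorem summable_gaussTerm {a b c : ℂ} (h : ‖a‖ + ‖b‖ < c.re) : Summable (gaussTerm a b c) :=
  .of_norm_bounded (summable_realGaussTerm (norm_nonneg a) (norm_nonneg b) h)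
    (norm_gaussTerm_le le_rfl le_rfl (by linarith [norm_nonneg a, norm_nonneg b]) le_rfl)

/-- The termwise difference of the two sides telescopes through `c n t n`, which tends to zero; the
extra `1` in the hypothesis pays for this limit. -/
theorem tsum_gaussTerm_succ {a b c : ℂ} (h : ‖a‖ + ‖b‖ + 1 < c.re) :
    c * (c - a - b) * ∑' n, gaussTerm a b c n =
      (c - a) * (c - b) * ∑' n, gaussTerm a b (c + 1) n := by
  have hc : 0 < c.re := by linarith [norm_nonneg a, norm_nonneg b]
  have hc0 : c ≠ 0 := by rintro rfl; simp at hc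
  have h1 := (summable_gaussTerm (by linarith : ‖a‖ + ‖b‖ < c.re)).mul_left (c * (c - a - b))
  have h2 := (summable_gaussTerm (by rw [Complex.add_re, Complex.one_re]; linarith :
    ‖a‖ + ‖b‖ < (c + 1).re)).mul_left ((c - a) * (c - b))
  have key : ∀ n : ℕ, c * (c - a - b) * gaussTerm a b c n -
      (c - a) * (c - b) * gaussTerm a b (c + 1) n =
      c * (n * gaussTerm a b c n) - c * ((n + 1 : ℕ) * gaussTerm a b c (n + 1)) := by
    intro n
    have e1 := poch_ne_zero_of_re_pos hc n
    have e2 : poch (c + 1) n ≠ 0 := poch_ne_zero_of_re_pos (by simp; linarith) n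
    have e3 : c + n ≠ 0 := by
      intro h0
      have : (c + n).re = 0 := by rw [h0]; simp
      simp at this
      linarith [(Nat.cast_nonneg n : (0 : ℝ) ≤ n)]
    have e4 : (n.factorial : ℂ) ≠ 0 := by exact_mod_cast n.factorial_ne_zero
    have e5 : poch (c + 1) n = poch c n * (c + n) / c := by
      rw [← poch_succ, poch_succ_left, mul_div_cancel_left₀ _ hc0]
    have e6 : (n : ℂ) + 1 ≠ 0 := by exact_mod_cast n.succ_ne_zero
    simp only [gaussTerm, poch_succ, Nat.factorial_succ, e5]
    push_cast
    field_simp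
    ring
  rw [← sub_eq_zero, ← tsum_mul_left, ← tsum_mul_left, ← h1.tsum_sub h2]
  refine tendsto_nhds_unique (h1.sub h2).hasSum.tendsto_sum_nat ?_
  have h3 : Filter.Tendsto (fun n : ℕ => (n : ℂ) * gaussTerm a b c n) Filter.atTop (𝓝 0) := by
    refine squeeze_zero_norm (fun n => ?_)
      (tendsto_natCast_mul_realGaussTerm (norm_nonneg a) (norm_nonneg b) h)
    rw [norm_mul, Complex.norm_natCast]
    gcongr
    exact norm_gaussTerm_le le_rfl le_rfl hc le_rfl n
  have h4 := (h3.const_mul c).const_sub 0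
  simp only [mul_zero, sub_zero] at h4
  refine h4.congr fun N => ?_
  rw [Finset.sum_congr rfl fun n _ => key n,
    Finset.sum_range_sub' (fun n : ℕ => c * ((n : ℂ) * gaussTerm a b c n))]
  simp

theorem tsum_gaussTerm_add_natCast {a b c : ℂ} (h : ‖a‖ + ‖b‖ + 1 < c.re) (N : ℕ) :
    poch c N * poch (c - a - b) N * ∑' n, gaussTerm a b c n =
      poch (c - a) N * poch (c - b) N * ∑' n, gaussTerm a b (c + N) n := by
  induction N with
  | zero => simp [poch_zero]
  | succ N ih =>
    have := tsum_gaussTerm_succ (a := a) (b := b) (c := c + N) (by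
      simp only [Complex.add_re, Complex.natCast_re]
      linarith [(Nat.cast_nonneg N : (0 : ℝ) ≤ N)])
    simp only [poch_succ]
    push_cast
    rw [← add_assoc c]
    linear_combination (c + N) * (c - a - b + N) * ih +
      poch (c - a) N * poch (c - b) N * this

/-- Every term but the constant one is `O(1 / N)`, and the real series with bottom parameter `Re c`
dominates. -/
theorem tendsto_tsum_gaussTerm {a b c : ℂ} (h : ‖a‖ + ‖b‖ < c.re) :
    Filter.Tendsto (fun N : ℕ => ∑' n, gaussTerm a b (c + N) n) Filter.atTop (𝓝 1) := by
  have hc : 0 < c.re := by linarith [norm_nonneg a, norm_nonneg b]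
  have hcN : ∀ N : ℕ, c.re + N ≤ (c + N).re := fun N => by simp
  have h1 : (1 : ℂ) = ∑' n : ℕ, if n = 0 then 1 else 0 := by simp
  rw [h1]
  refine tendsto_tsum_of_dominated_convergence
    (summable_realGaussTerm (norm_nonneg a) (norm_nonneg b) h) (fun n => ?_)
    (Filter.Eventually.of_forall fun N n => norm_gaussTerm_le le_rfl le_rfl hc
      (by have := hcN N; linarith [(Nat.cast_nonneg N : (0 : ℝ) ≤ N)]) n)
  rcases n with _ | n
  · simp [gaussTerm, poch_zero]
  · rw [if_neg n.succ_ne_zero]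
    refine squeeze_zero_norm (a := fun N : ℕ => realPoch ‖a‖ (n + 1) * realPoch ‖b‖ (n + 1) /
      realPoch c.re n * (c.re + N)⁻¹) (fun N => ?_) ?_
    · refine (norm_gaussTerm_le le_rfl le_rfl (by positivity) (hcN N) (n + 1)).trans ?_
      have p1 := realPoch_pos hc n
      have p2 := realPoch_nonneg (norm_nonneg a) (n + 1)
      have p3 := realPoch_nonneg (norm_nonneg b) (n + 1)
      have hle : realPoch c.re n * (c.re + N) ≤ realPoch (c.re + N) (n + 1) * (n + 1).factorial := by
        have h5 : realPoch c.re n * (c.re + N) ≤ realPoch (c.re + N) (n + 1) := by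
          rw [realPoch_succ]
          have : realPoch c.re n ≤ realPoch (c.re + N) n := realPoch_mono hc.le (by simp) n
          exact mul_le_mul this (by simp) (by positivity) (realPoch_nonneg (by positivity) n)
        have h6 : (1 : ℝ) ≤ (n + 1).factorial := by exact_mod_cast Nat.factorial_pos _
        exact h5.trans (le_mul_of_one_le_right (realPoch_nonneg (by positivity) _) h6)
      rw [realGaussTerm, ← div_eq_mul_inv, div_div]
      gcongr
    · have h7 : Filter.Tendsto (fun N : ℕ => (c.re + N)⁻¹) Filter.atTop (𝓝 0) :=
        tendsto_inv_atTop_zero.comp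
          (Filter.tendsto_atTop_add_const_left _ c.re tendsto_natCast_atTop_atTop)
      simpa using h7.const_mul (realPoch ‖a‖ (n + 1) * realPoch ‖b‖ (n + 1) / realPoch c.re n)

theorem GammaSeq_eq_div_poch (s : ℂ) (n : ℕ) :
    Complex.GammaSeq s n = (n : ℂ) ^ s * n.factorial / poch s (n + 1) := by
  rw [Complex.GammaSeq, poch_eq_prod]

/-- **Gauss's summation theorem**. -/
theorem tsum_gaussTerm {a b c : ℂ} (h : ‖a‖ + ‖b‖ + 1 < c.re) :
    ∑' n, gaussTerm a b c n =
      Complex.Gamma c * Complex.Gamma (c - a - b) /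
        (Complex.Gamma (c - a) * Complex.Gamma (c - b)) := by
  have hA := Complex.re_le_norm a
  have hB := Complex.re_le_norm b
  have hA0 := norm_nonneg a
  have hB0 := norm_nonneg b
  have p1 : 0 < c.re := by linarith
  have p2 : 0 < (c - a).re := by simp; linarith
  have p3 : 0 < (c - b).re := by simp; linarith
  have p4 : 0 < (c - a - b).re := by simp; linarith
  -- The iterated contiguous relation leaves a quotient of four Pochhammer symbols, which is a
  -- quotient of Euler's products for `Γ`: the powers of `n` cancel because `c + (c - a - b) = (c -
  -- a) + (c - b)`.
  have hlim : Filter.Tendsto (fun n : ℕ => Complex.GammaSeq c n * Complex.GammaSeq (c - a - b) n /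
      (Complex.GammaSeq (c - a) n * Complex.GammaSeq (c - b) n) *
      ∑' k, gaussTerm a b (c + (n + 1 : ℕ)) k) Filter.atTop
      (𝓝 (Complex.Gamma c * Complex.Gamma (c - a - b) /
        (Complex.Gamma (c - a) * Complex.Gamma (c - b)) * 1)) := by
    refine Filter.Tendsto.mul ?_ ((tendsto_tsum_gaussTerm (by linarith)).comp
      (Filter.tendsto_add_atTop_nat 1))
    refine Filter.Tendsto.div ((Complex.GammaSeq_tendsto_Gamma _).mul
      (Complex.GammaSeq_tendsto_Gamma _)) ((Complex.GammaSeq_tendsto_Gamma _).mul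
      (Complex.GammaSeq_tendsto_Gamma _)) (mul_ne_zero ?_ ?_)
    · exact Complex.Gamma_ne_zero_of_re_pos p2
    · exact Complex.Gamma_ne_zero_of_re_pos p3
  rw [mul_one] at hlim
  refine tendsto_nhds_unique (tendsto_const_nhds.congr' ?_) hlim
  filter_upwards [Filter.eventually_gt_atTop 0] with n hn
  have hn0 : (n : ℂ) ≠ 0 := by exact_mod_cast hn.ne'
  have key := tsum_gaussTerm_add_natCast h (n + 1)
  have q1 := poch_ne_zero_of_re_pos p1 (n + 1)
  have q2 := poch_ne_zero_of_re_pos p2 (n + 1)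
  have q3 := poch_ne_zero_of_re_pos p3 (n + 1)
  have q4 := poch_ne_zero_of_re_pos p4 (n + 1)
  have hf : (n.factorial : ℂ) ≠ 0 := by exact_mod_cast n.factorial_ne_zero
  have r1 : (n : ℂ) ^ (c - a) ≠ 0 := by simp [Complex.cpow_eq_zero_iff, hn0]
  have r2 : (n : ℂ) ^ (c - b) ≠ 0 := by simp [Complex.cpow_eq_zero_iff, hn0]
  have hpow : (n : ℂ) ^ c * (n : ℂ) ^ (c - a - b) = (n : ℂ) ^ (c - a) * (n : ℂ) ^ (c - b) := by
    rw [← Complex.cpow_add _ _ hn0, ← Complex.cpow_add _ _ hn0]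
    congr 1
    ring
  simp only [GammaSeq_eq_div_poch]
  set S := ∑' k, gaussTerm a b (c + (n + 1 : ℕ)) k
  have e : (n : ℂ) ^ c * n.factorial / poch c (n + 1) *
      ((n : ℂ) ^ (c - a - b) * n.factorial / poch (c - a - b) (n + 1)) /
      ((n : ℂ) ^ (c - a) * n.factorial / poch (c - a) (n + 1) *
      ((n : ℂ) ^ (c - b) * n.factorial / poch (c - b) (n + 1))) =
      poch (c - a) (n + 1) * poch (c - b) (n + 1) / (poch c (n + 1) * poch (c - a - b) (n + 1)) := by
    field_simp
    linear_combination hpow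
  rw [e, div_mul_eq_mul_div, ← key]
  field_simp

theorem tsum_realGaussTerm {x y r : ℝ} (hx : 0 ≤ x) (hy : 0 ≤ y) (h : x + y + 1 < r) :
    ∑' n, realGaussTerm x y r n =
      Real.Gamma r * Real.Gamma (r - x - y) / (Real.Gamma (r - x) * Real.Gamma (r - y)) := by
  apply Complex.ofReal_injective
  have := tsum_gaussTerm (a := x) (b := y) (c := r)
    (by simpa [abs_of_nonneg hx, abs_of_nonneg hy] using h)
  simp only [Complex.ofReal_tsum, ofReal_realGaussTerm]
  rw [this]
  push_cast [← Complex.Gamma_ofReal]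
  rfl

theorem realGamma_add_natCast {r : ℝ} (hr : 0 < r) (m : ℕ) :
    Real.Gamma (r + m) = realPoch r m * Real.Gamma r := by
  apply Complex.ofReal_injective
  push_cast [← Complex.Gamma_ofReal, ofReal_realPoch]
  exact Gamma_add_natCast (not_isGammaPole_of_re_pos (by simpa using hr)) m

/-! ### The double series at unit arguments. -/

/-- The double series of `doubleCoeff` at unit arguments, for non-negative parameters. -/
theorem summable_realGaussTerm_prod {x x' y w s : ℝ} (hx : 0 ≤ x) (hx' : 0 ≤ x') (hy : 0 ≤ y)
    (hw : 0 ≤ w) (hs : x + x' + y + w + 1 < s) :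
    Summable fun k : ℕ × ℕ => realGaussTerm x y s k.1 * realGaussTerm x' (w + k.1) (s + k.1) k.2 := by
  have hs0 : 0 < s := by linarith
  have hsx : 0 < s - x' := by linarith
  refine (summable_prod_of_nonneg fun k => ?_).2 ⟨fun m => ?_, ?_⟩
  · exact mul_nonneg (realGaussTerm_nonneg hx hy hs0 _)
      (realGaussTerm_nonneg hx' (by positivity) (by positivity) _)
  · exact (summable_realGaussTerm (x := x') (y := w + m) (r := s + m) hx' (by positivity)
      (by linarith)).mul_left (realGaussTerm x y s m)
  · have e : ∀ m : ℕ, ∑' n, realGaussTerm x y s m * realGaussTerm x' (w + m) (s + m) n =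
        Real.Gamma s * Real.Gamma (s - x' - w) / (Real.Gamma (s - x') * Real.Gamma (s - w)) *
          realGaussTerm x y (s - x') m := by
      intro m
      have q1 := (realPoch_pos hs0 m).ne'
      have q2 := (realPoch_pos hsx m).ne'
      have q3 := (Real.Gamma_pos_of_pos hs0).ne'
      have q4 := (Real.Gamma_pos_of_pos hsx).ne'
      rw [tsum_mul_left, tsum_realGaussTerm hx' (by positivity) (by linarith),
        realGamma_add_natCast hs0, show s + m - x' = s - x' + m by ring, realGamma_add_natCast hsx,
        show s - x' + m - (w + m) = s - x' - w by ring, show s + m - (w + m) = s - w by ring,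
        realGaussTerm, realGaussTerm]
      field_simp
    simp only [e]
    exact (summable_realGaussTerm hx hy (by linarith)).mul_left _

theorem doubleCoeff_eq_gaussTerm (A A' B : ℂ) (D : ℕ → ℂ) (G : ℂ) (m n : ℕ) :
    doubleCoeff A A' B D G (m, n) = gaussTerm A B G m * gaussTerm A' (D m) (G + m) n :=
  doubleCoeff_eq A A' B D G m n

theorem summable_doubleCoeff {A A' B b S : ℂ} (hS : ‖A‖ + ‖A'‖ + ‖B‖ + ‖b‖ + 1 < S.re) :
    Summable (doubleCoeff A A' B (fun m => b + m) S) := by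
  have := norm_nonneg A
  have := norm_nonneg A'
  have := norm_nonneg B
  have := norm_nonneg b
  have hS0 : 0 < S.re := by linarith
  refine .of_norm_bounded (summable_realGaussTerm_prod (norm_nonneg A) (norm_nonneg A')
    (norm_nonneg B) (norm_nonneg b) hS) fun ⟨m, n⟩ => ?_
  rw [doubleCoeff_eq_gaussTerm, norm_mul]
  gcongr
  · exact realGaussTerm_nonneg (by positivity) (by positivity) (by positivity) _
  · exact norm_gaussTerm_le le_rfl le_rfl hS0 le_rfl m
  · refine norm_gaussTerm_le le_rfl ?_ (by positivity) (by simp) n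
    simpa using norm_add_le b (m : ℂ)

/-- Gauss's theorem applies twice. In the inner sum the upper `b + m` and the lower `S + m` move
together, so `m` survives only in `Γ(S + m) / Γ(S - A' + m)`; this trades `(S)_m` for `(S - A')_m`
and leaves a Gauss series in `m`. -/
theorem tsum_doubleCoeff {A A' B b S : ℂ} (hS : ‖A‖ + ‖A'‖ + ‖B‖ + ‖b‖ + 1 < S.re) :
    ∑' k, doubleCoeff A A' B (fun m => b + m) S k =
      Complex.Gamma S * Complex.Gamma (S - A' - b) * Complex.Gamma (S - A' - A - B) /
        (Complex.Gamma (S - b) * Complex.Gamma (S - A' - A) * Complex.Gamma (S - A' - B)) := by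
  have := norm_nonneg A
  have := norm_nonneg A'
  have := norm_nonneg B
  have := norm_nonneg b
  have := Complex.re_le_norm A'
  have := Complex.re_le_norm b
  have hS0 : 0 < S.re := by linarith
  have hSA : 0 < (S - A').re := by simp; linarith
  have e : ∀ m : ℕ, ∑' n, doubleCoeff A A' B (fun m => b + m) S (m, n) =
        Complex.Gamma S * Complex.Gamma (S - A' - b) /
          (Complex.Gamma (S - A') * Complex.Gamma (S - b)) * gaussTerm A B (S - A') m := by
    intro m
    have q1 := poch_ne_zero_of_re_pos hS0 m
    have q2 := poch_ne_zero_of_re_pos hSA m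
    have q3 := Complex.Gamma_ne_zero_of_re_pos hS0
    have q4 := Complex.Gamma_ne_zero_of_re_pos hSA
    have hm : ‖b + m‖ ≤ ‖b‖ + m := by simpa using norm_add_le b (m : ℂ)
    simp only [doubleCoeff_eq_gaussTerm]
    rw [tsum_mul_left, tsum_gaussTerm (by simp; linarith),
      Gamma_add_natCast (not_isGammaPole_of_re_pos hS0),
      show S + m - A' = S - A' + m by ring, Gamma_add_natCast (not_isGammaPole_of_re_pos hSA),
      show S - A' + m - (b + m) = S - A' - b by ring, show S + m - (b + m) = S - b by ring,
      gaussTerm, gaussTerm]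
    field_simp
  have q4 := Complex.Gamma_ne_zero_of_re_pos hSA
  rw [(summable_doubleCoeff hS).tsum_prod]
  simp only [e]
  rw [tsum_mul_left, tsum_gaussTerm (by rw [Complex.sub_re]; linarith)]
  field_simp

/-! ### The Mellin transform of the kernel. -/

open MeasureTheory

theorem integrable_of_eq_tsum {X ι : Type*} [Countable ι] {m : MeasurableSpace X} {κ : Measure X}
    {F : ι → X → ℂ} {f : X → ℂ} (hF : ∀ i, Integrable (F i) κ)
    (hs : Summable fun i => ∫ a, ‖F i a‖ ∂κ) (hf : AEStronglyMeasurable f κ)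
    (hfF : ∀ᵐ a ∂κ, f a = ∑' i, F i a) : Integrable f κ := by
  refine ⟨hf, ?_⟩
  calc ∫⁻ a, ‖f a‖ₑ ∂κ ≤ ∫⁻ a, ∑' i, ‖F i a‖ₑ ∂κ := by
        refine lintegral_mono_ae (hfF.mono fun a ha => ?_)
        rw [ha]
        exact enorm_tsum_le_tsum_enorm
    _ = ∑' i, ENNReal.ofReal (∫ a, ‖F i a‖ ∂κ) := by
        rw [lintegral_tsum fun i => (hF i).1.enorm]
        exact tsum_congr fun i => (ofReal_integral_norm_eq_lintegral_enorm (hF i)).symm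
    _ < ⊤ := hs.tsum_ofReal_lt_top

/-- The kernel of the Saigo–Maeda operators on `(0, 1)`, without its power factor. -/
noncomputable def saigoKernel (A A' B B' G : ℂ) (u : ℝ) : ℂ :=
  ((1 - u : ℝ) : ℂ) ^ (G - 1) * pfaffSeries A A' B B' G ((1 - u : ℝ) : ℂ) ((1 - u : ℝ) : ℂ)

theorem continuousOn_saigoKernel (A A' B B' : ℂ) {G : ℂ} (hG : 0 < G.re) :
    ContinuousOn (saigoKernel A A' B B' G) (Set.Ioo 0 1) := by
  have hp : ∀ v ∈ Metric.ball (0 : ℂ) 1,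
      ContinuousAt (fun v => pfaffSeries A A' B B' G v v) v := by
    intro v hv
    obtain ⟨q, hvq, hq1⟩ := exists_between (mem_ball_zero_iff.1 hv)
    have hd := differentiableOn_pfaffSeries A A' B B' hG ((norm_nonneg v).trans hvq.le) hq1
      (U := Metric.ball 0 q) Metric.isOpen_ball (X := id) (Y := id) differentiableOn_id
      differentiableOn_id (fun s hs => (mem_ball_zero_iff.1 hs).le)
      (fun s hs => (mem_ball_zero_iff.1 hs).le)
    exact (hd.differentiableAt (Metric.isOpen_ball.mem_nhds (by simpa using hvq))).continuousAt
  intro u hu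
  refine ContinuousAt.continuousWithinAt (ContinuousAt.mul ?_ ?_)
  · refine ContinuousAt.cpow (by fun_prop) (by fun_prop) (Or.inl ?_)
    rw [Complex.ofReal_re]
    linarith [hu.2]
  · refine ContinuousAt.comp (g := fun v => pfaffSeries A A' B B' G v v)
      (f := fun u : ℝ => ((1 - u : ℝ) : ℂ)) (hp _ ?_) (by fun_prop)
    rw [mem_ball_zero_iff, Complex.norm_real, Real.norm_eq_abs, abs_lt]
    constructor <;> linarith [hu.1, hu.2]

theorem integrableOn_beta {s t : ℂ} (hs : 0 < s.re) (ht : 0 < t.re) :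
    IntegrableOn (fun u : ℝ => (u : ℂ) ^ (s - 1) * ((1 - u : ℝ) : ℂ) ^ (t - 1))
      (Set.Ioo 0 1) := by
  have := Complex.betaIntegral_convergent hs ht
  rw [intervalIntegrable_iff_integrableOn_Ioo_of_le zero_le_one] at this
  simpa using this

theorem setIntegral_beta {s t : ℂ} (hs : 0 < s.re) (ht : 0 < t.re) :
    ∫ u in Set.Ioo (0 : ℝ) 1, (u : ℂ) ^ (s - 1) * ((1 - u : ℝ) : ℂ) ^ (t - 1) =
      Complex.Gamma s * Complex.Gamma t / Complex.Gamma (s + t) := by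
  rw [Complex.Gamma_mul_Gamma_eq_betaIntegral hs ht, mul_div_cancel_left₀ _
    (Complex.Gamma_ne_zero_of_re_pos (by simpa using by linarith)), Complex.betaIntegral,
    intervalIntegral.integral_of_le zero_le_one, integral_Ioc_eq_integral_Ioo]
  simp

theorem setIntegral_beta_add_natCast {s t : ℂ} (hs : 0 < s.re) (ht : 0 < t.re) (N : ℕ) :
    ∫ u in Set.Ioo (0 : ℝ) 1, (u : ℂ) ^ (s - 1) * ((1 - u : ℝ) : ℂ) ^ (t + N - 1) =
      Complex.Gamma s * Complex.Gamma t / Complex.Gamma (s + t) * (poch t N / poch (s + t) N) := by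
  rw [setIntegral_beta hs (by simp; positivity), ← add_assoc,
    Gamma_add_natCast (not_isGammaPole_of_re_pos ht),
    Gamma_add_natCast (not_isGammaPole_of_re_pos (by simpa using by linarith))]
  have := Complex.Gamma_ne_zero_of_re_pos (s := s + t) (by simpa using by linarith)
  have := poch_ne_zero_of_re_pos (a := s + t) (by simpa using by linarith) N
  field_simp

theorem norm_ofReal_cpow_mul {s t : ℂ} {u : ℝ} (hu : u ∈ Set.Ioo 0 1) :
    ((‖(u : ℂ) ^ (s - 1) * ((1 - u : ℝ) : ℂ) ^ (t - 1)‖ : ℝ) : ℂ) =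
      (u : ℂ) ^ ((s.re : ℂ) - 1) * ((1 - u : ℝ) : ℂ) ^ ((t.re : ℂ) - 1) := by
  have h1 : 0 < 1 - u := by linarith [hu.2]
  rw [norm_mul, Complex.norm_cpow_eq_rpow_re_of_pos hu.1, Complex.norm_cpow_eq_rpow_re_of_pos h1,
    Complex.ofReal_mul, Complex.ofReal_cpow hu.1.le, Complex.ofReal_cpow h1.le]
  simp

theorem setIntegral_norm_beta_add_natCast {s t : ℂ} (hs : 0 < s.re) (ht : 0 < t.re) (N : ℕ) :
    ∫ u in Set.Ioo (0 : ℝ) 1, ‖(u : ℂ) ^ (s - 1) * ((1 - u : ℝ) : ℂ) ^ (t + N - 1)‖ =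
      Real.Gamma s.re * Real.Gamma t.re / Real.Gamma (s.re + t.re) *
        (realPoch t.re N / realPoch (s.re + t.re) N) := by
  apply Complex.ofReal_injective
  rw [← integral_complex_ofReal, setIntegral_congr_fun measurableSet_Ioo
    (fun u hu => norm_ofReal_cpow_mul hu)]
  have := setIntegral_beta_add_natCast (s := s.re) (t := t.re) (by simpa) (by simpa) N
  push_cast [← Complex.Gamma_ofReal, ofReal_realPoch]
  simpa using this

/-- The Mellin transform of the kernel, far to the right. -/
theorem mellin_saigoKernel_of_large (A A' B B' : ℂ) {G ρ : ℂ} (hG : 0 < G.re)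
    (hρ : ‖A‖ + ‖A'‖ + ‖B‖ + ‖G - B'‖ + 1 < ρ.re) :
    IntegrableOn (fun u : ℝ => (u : ℂ) ^ (ρ - 1) * saigoKernel A A' B B' G u) (Set.Ioo 0 1) ∧
    ∫ u in Set.Ioo (0 : ℝ) 1, (u : ℂ) ^ (ρ - 1) * saigoKernel A A' B B' G u =
      Complex.Gamma G * (Complex.Gamma ρ * Complex.Gamma (ρ + G - A - A' - B) *
        Complex.Gamma (ρ + B' - A') / (Complex.Gamma (ρ + B') * Complex.Gamma (ρ + G - A - A') *
        Complex.Gamma (ρ + G - A' - B))) := by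
  have hρ0 : 0 < ρ.re := lt_of_le_of_lt (by positivity) hρ
  have hS0 : 0 < (ρ + G).re := by simpa using by linarith
  set d := doubleCoeff A A' B (fun m => G - B' + m) G with hd
  let F : ℕ × ℕ → ℝ → ℂ := fun k u =>
    d k * ((u : ℂ) ^ (ρ - 1) * ((1 - u : ℝ) : ℂ) ^ (G + (k.1 + k.2 : ℕ) - 1))
  have hF : ∀ k, Integrable (F k) (volume.restrict (Set.Ioo 0 1)) := fun k =>
    (integrableOn_beta hρ0 (by simp; positivity)).const_mul _
  have hFsum : ∀ u ∈ Set.Ioo (0 : ℝ) 1,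
      (u : ℂ) ^ (ρ - 1) * saigoKernel A A' B B' G u = ∑' k, F k u := by
    intro u hu
    have h1 : ((1 - u : ℝ) : ℂ) ≠ 0 := by
      exact_mod_cast (sub_pos.2 hu.2).ne'
    rw [saigoKernel, pfaffSeries, ← tsum_mul_left, ← tsum_mul_left]
    refine tsum_congr fun k => ?_
    simp only [F]
    rw [show G + (k.1 + k.2 : ℕ) - 1 = G - 1 + (k.1 + k.2 : ℕ) by ring,
      Complex.cpow_add _ _ h1, Complex.cpow_natCast, pow_add]
    ring
  -- The Beta integral trades the bottom parameter `G` for `ρ + G`.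
  have hdS : ∀ k, d k * (poch G (k.1 + k.2) / poch (ρ + G) (k.1 + k.2)) =
      doubleCoeff A A' B (fun m => G - B' + m) (ρ + G) k := by
    intro k
    have e1 := poch_ne_zero_of_re_pos hG (k.1 + k.2)
    have e2 := poch_ne_zero_of_re_pos hS0 (k.1 + k.2)
    simp only [hd, doubleCoeff]
    field_simp
  -- Absolute values replace `ρ` and `G` by real parts in the Beta integral; since `(Re G)_N ≤
  -- |(G)_N|`, the double series with bottom parameter `Re ρ + Re G` is a majorant.
  have hsum : Summable fun k => ∫ u in Set.Ioo (0 : ℝ) 1, ‖F k u‖ := by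
    have hs := (summable_doubleCoeff (A := A) (A' := A') (B := B) (b := G - B')
      (S := ((ρ.re + G.re : ℝ) : ℂ)) (by rw [Complex.ofReal_re]; linarith)).norm.mul_left
      (Real.Gamma ρ.re * Real.Gamma G.re / Real.Gamma (ρ.re + G.re))
    refine hs.of_nonneg_of_le (fun k => integral_nonneg fun _ => norm_nonneg _) fun k => ?_
    simp only [F, norm_mul (d k)]
    rw [integral_const_mul, setIntegral_norm_beta_add_natCast hρ0 hG]
    have g1 := Real.Gamma_pos_of_pos hρ0
    have g2 := Real.Gamma_pos_of_pos hG
    have g3 := Real.Gamma_pos_of_pos (add_pos hρ0 hG)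
    rw [mul_left_comm]
    refine mul_le_mul_of_nonneg_left ?_ (by positivity)
    have p1 := realPoch_pos hG (k.1 + k.2)
    have p2 := realPoch_pos (add_pos hρ0 hG) (k.1 + k.2)
    have p3 := realPoch_le_norm_poch hG.le le_rfl (k.1 + k.2)
    have p4 : ‖poch ((ρ.re + G.re : ℝ) : ℂ) (k.1 + k.2)‖ = realPoch (ρ.re + G.re) (k.1 + k.2) := by
      rw [← ofReal_realPoch, Complex.norm_real, Real.norm_of_nonneg p2.le]
    simp only [hd, doubleCoeff, norm_div, norm_mul, Complex.norm_natCast, p4]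
    have p5 := p1.trans_le p3
    rw [div_div, div_mul_div_comm, div_div]
    rw [div_le_div_iff₀ (by positivity) (by positivity)]
    have : realPoch G.re (k.1 + k.2) * realPoch (ρ.re + G.re) (k.1 + k.2) ≤
      ‖poch G (k.1 + k.2)‖ * realPoch (ρ.re + G.re) (k.1 + k.2) := by gcongr
    calc _ = (‖poch A k.1‖ * ‖poch A' k.2‖ * ‖poch B k.1‖ * ‖poch (G - B' + k.1) k.2‖ *
          (k.1.factorial * k.2.factorial)) *
          (realPoch G.re (k.1 + k.2) * realPoch (ρ.re + G.re) (k.1 + k.2)) := by ring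
      _ ≤ (‖poch A k.1‖ * ‖poch A' k.2‖ * ‖poch B k.1‖ * ‖poch (G - B' + k.1) k.2‖ *
          (k.1.factorial * k.2.factorial)) *
          (‖poch G (k.1 + k.2)‖ * realPoch (ρ.re + G.re) (k.1 + k.2)) := by gcongr
      _ = _ := by ring
  have hmeas : AEStronglyMeasurable (fun u : ℝ => (u : ℂ) ^ (ρ - 1) * saigoKernel A A' B B' G u)
      (volume.restrict (Set.Ioo 0 1)) := by
    refine ContinuousOn.aestronglyMeasurable (ContinuousOn.mul (fun u hu => ?_)
      (continuousOn_saigoKernel A A' B B' hG)) measurableSet_Ioo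
    exact (Complex.continuousAt_ofReal_cpow_const _ _ (Or.inr hu.1.ne')).continuousWithinAt
  refine ⟨integrable_of_eq_tsum hF hsum hmeas
    ((ae_restrict_iff' measurableSet_Ioo).2 (.of_forall hFsum)), ?_⟩
  rw [setIntegral_congr_fun measurableSet_Ioo hFsum,
    ← integral_tsum_of_summable_integral_norm hF hsum]
  have e : ∀ k, ∫ u in Set.Ioo (0 : ℝ) 1, F k u =
      Complex.Gamma ρ * Complex.Gamma G / Complex.Gamma (ρ + G) *
        doubleCoeff A A' B (fun m => G - B' + m) (ρ + G) k := by
    intro k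
    simp only [F]
    rw [integral_const_mul, setIntegral_beta_add_natCast hρ0 hG, ← hdS]
    ring
  have g3 := Complex.Gamma_ne_zero_of_re_pos hS0
  rw [tsum_congr e, tsum_mul_left, tsum_doubleCoeff (by rw [Complex.add_re]; linarith),
    show ρ + G - A' - (G - B') = ρ + B' - A' by ring, show ρ + G - (G - B') = ρ + B' by ring,
    show ρ + G - A' - A = ρ + G - A - A' by ring]
  field_simp

theorem continuousOn_ofReal_cpow_const (s : ℂ) :
    ContinuousOn (fun u : ℝ => (u : ℂ) ^ s) (Set.Ioo 0 1) := fun _ hu =>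
  (Complex.continuousAt_ofReal_cpow_const _ _ (Or.inr hu.1.ne')).continuousWithinAt

section Mellin

variable {K : ℝ → ℂ}

theorem aestronglyMeasurable_cpow_mul (hK : ContinuousOn K (Set.Ioo 0 1)) (s : ℂ) :
    AEStronglyMeasurable (fun u : ℝ => (u : ℂ) ^ s * K u) (volume.restrict (Set.Ioo 0 1)) :=
  ((continuousOn_ofReal_cpow_const s).mul hK).aestronglyMeasurable measurableSet_Ioo

theorem norm_cpow_mul_le {s t : ℂ} (h : s.re ≤ t.re) {u : ℝ} (hu : u ∈ Set.Ioo 0 1) (w : ℂ) :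
    ‖(u : ℂ) ^ (t - 1) * w‖ ≤ ‖(u : ℂ) ^ (s - 1) * w‖ := by
  rw [norm_mul, norm_mul, Complex.norm_cpow_eq_rpow_re_of_pos hu.1,
    Complex.norm_cpow_eq_rpow_re_of_pos hu.1]
  refine mul_le_mul_of_nonneg_right ?_ (norm_nonneg _)
  exact Real.rpow_le_rpow_of_exponent_ge hu.1 hu.2.le (by simpa using h)

theorem integrableOn_cpow_mul_of_re_le (hK : ContinuousOn K (Set.Ioo 0 1)) {s t : ℂ}
    (h : s.re ≤ t.re)
    (hs : IntegrableOn (fun u : ℝ => (u : ℂ) ^ (s - 1) * K u) (Set.Ioo 0 1)) :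
    IntegrableOn (fun u : ℝ => (u : ℂ) ^ (t - 1) * K u) (Set.Ioo 0 1) :=
  Integrable.mono hs (aestronglyMeasurable_cpow_mul hK _)
    ((ae_restrict_iff' measurableSet_Ioo).2 (.of_forall fun u hu => norm_cpow_mul_le h hu (K u)))

theorem differentiableOn_setIntegral_cpow_mul (hK : ContinuousOn K (Set.Ioo 0 1)) {s : ℂ}
    (hs : IntegrableOn (fun u : ℝ => (u : ℂ) ^ (s - 1) * K u) (Set.Ioo 0 1)) :
    DifferentiableOn ℂ (fun t : ℂ => ∫ u in Set.Ioo (0 : ℝ) 1, (u : ℂ) ^ (t - 1) * K u)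
      {t | s.re < t.re} := by
  intro t ht
  have ht : s.re < t.re := ht
  -- Half the gap keeps exponents in the ball beyond `Re s + ε`; the spare `u ^ ε` absorbs the
  -- logarithm, as `|u ^ ε log u| ≤ 1 / ε`.
  set ε := (t.re - s.re) / 2 with hε
  have hε0 : 0 < ε := by rw [hε]; linarith
  have key := hasDerivAt_integral_of_dominated_loc_of_deriv_le
    (μ := volume.restrict (Set.Ioo (0 : ℝ) 1)) (x₀ := t) (s := Metric.ball t ε)
    (F := fun t u => (u : ℂ) ^ (t - 1) * K u)
    (F' := fun t u => (u : ℂ) ^ (t - 1) * (Complex.log u * K u))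
    (bound := fun u => 1 / ε * ‖(u : ℂ) ^ (s - 1) * K u‖)
    (Metric.ball_mem_nhds t hε0)
    (.of_forall fun w => aestronglyMeasurable_cpow_mul hK _)
    (integrableOn_cpow_mul_of_re_le hK ht.le hs) ?_ ?_ (hs.norm.const_mul _) ?_
  · exact key.2.differentiableAt.differentiableWithinAt
  · refine aestronglyMeasurable_cpow_mul (ContinuousOn.mul (fun u hu => ?_) hK) _
    refine ContinuousAt.continuousWithinAt ?_
    exact ContinuousAt.comp (g := Complex.log) (f := fun u : ℝ => (u : ℂ))
      (continuousAt_clog (Or.inl (by simpa using hu.1))) (by fun_prop)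
  · refine (ae_restrict_iff' measurableSet_Ioo).2 (.of_forall fun u hu w hw => ?_)
    have hw' : s.re + ε ≤ w.re := by
      have h1 := (Complex.abs_re_le_norm (w - t)).trans_lt (mem_ball_iff_norm.1 hw)
      rw [Complex.sub_re, abs_lt] at h1
      linarith
    refine (norm_cpow_mul_le (s := s + (ε : ℂ)) (by simpa using hw') hu _).trans ?_
    have hu0 : (u : ℂ) ≠ 0 := by exact_mod_cast hu.1.ne'
    have hlog : ‖(u : ℂ) ^ (ε : ℂ) * Complex.log u‖ ≤ 1 / ε := by
      rw [norm_mul, Complex.norm_cpow_eq_rpow_re_of_pos hu.1, ← Complex.ofReal_log hu.1.le,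
        Complex.norm_real, Complex.ofReal_re, mul_comm, Real.norm_eq_abs,
        ← abs_of_nonneg (Real.rpow_nonneg hu.1.le ε), ← abs_mul]
      exact (Real.abs_log_mul_self_rpow_lt u ε hu.1 hu.2.le hε0).le
    calc ‖(u : ℂ) ^ (s + (ε : ℂ) - 1) * (Complex.log u * K u)‖
        = ‖(u : ℂ) ^ (ε : ℂ) * Complex.log u‖ * ‖(u : ℂ) ^ (s - 1) * K u‖ := by
          rw [← norm_mul, show s + (ε : ℂ) - 1 = s - 1 + ε by ring, Complex.cpow_add _ _ hu0]
          congr 1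
          ring
      _ ≤ _ := by gcongr
  · refine (ae_restrict_iff' measurableSet_Ioo).2 (.of_forall fun u hu w hw => ?_)
    have hu0 : (u : ℂ) ≠ 0 := by exact_mod_cast hu.1.ne'
    have h1 := (((hasDerivAt_id w).sub_const 1).const_cpow (c := (u : ℂ)) (Or.inl hu0)).mul_const
      (K u)
    exact HasDerivAt.congr_deriv (f := fun t : ℂ => (u : ℂ) ^ (t - 1) * K u) h1 (by
      simp only [id]; ring)

/-- Reaches `s` itself, which may lie on the edge of the half-plane of absolute convergence, where
analyticity is unavailable. -/
theorem tendsto_setIntegral_cpow_mul (hK : ContinuousOn K (Set.Ioo 0 1)) {s : ℂ}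
    (hs : IntegrableOn (fun u : ℝ => (u : ℂ) ^ (s - 1) * K u) (Set.Ioo 0 1)) :
    Filter.Tendsto (fun n : ℕ => ∫ u in Set.Ioo (0 : ℝ) 1,
      (u : ℂ) ^ (s + ((1 / ((n : ℝ) + 1) : ℝ) : ℂ) - 1) * K u) Filter.atTop
      (𝓝 (∫ u in Set.Ioo (0 : ℝ) 1, (u : ℂ) ^ (s - 1) * K u)) := by
  refine tendsto_integral_of_dominated_convergence (fun u => ‖(u : ℂ) ^ (s - 1) * K u‖)
    (fun n => aestronglyMeasurable_cpow_mul hK _) hs.norm (fun n => ?_) ?_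
  · refine (ae_restrict_iff' measurableSet_Ioo).2 (.of_forall fun u hu =>
      norm_cpow_mul_le ?_ hu (K u))
    rw [Complex.add_re, Complex.ofReal_re]
    have : 0 ≤ 1 / ((n : ℝ) + 1) := by positivity
    linarith
  · refine (ae_restrict_iff' measurableSet_Ioo).2 (.of_forall fun u hu => ?_)
    have hu0 : (u : ℂ) ≠ 0 := by exact_mod_cast hu.1.ne'
    refine Filter.Tendsto.mul_const _ ?_
    have h1 : Filter.Tendsto (fun n : ℕ => s + ((1 / ((n : ℝ) + 1) : ℝ) : ℂ) - 1) Filter.atTop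
        (𝓝 (s + ((0 : ℝ) : ℂ) - 1)) :=
      (((Complex.continuous_ofReal.tendsto _).comp
        tendsto_one_div_add_atTop_nhds_zero_nat).const_add s).sub_const 1
    rw [Complex.ofReal_zero, add_zero] at h1
    exact (continuousAt_const_cpow hu0).tendsto.comp h1
end Mellin

/-- The Mellin transform of the kernel, wherever it converges absolutely. -/
theorem mellin_saigoKernel (A A' B B' : ℂ) {G ρ : ℂ} (hG : 0 < G.re)
    (hint : IntegrableOn (fun u : ℝ => (u : ℂ) ^ (ρ - 1) * saigoKernel A A' B B' G u)
      (Set.Ioo 0 1))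
    (h1 : ¬ IsGammaPole ρ) (h2 : ¬ IsGammaPole (ρ + G - A - A' - B))
    (h3 : ¬ IsGammaPole (ρ + B' - A')) :
    ∫ u in Set.Ioo (0 : ℝ) 1, (u : ℂ) ^ (ρ - 1) * saigoKernel A A' B B' G u =
      Complex.Gamma G * (Complex.Gamma ρ * Complex.Gamma (ρ + G - A - A' - B) *
        Complex.Gamma (ρ + B' - A') / (Complex.Gamma (ρ + B') * Complex.Gamma (ρ + G - A - A') *
        Complex.Gamma (ρ + G - A' - B))) := by
  have hK := continuousOn_saigoKernel A A' B B' hG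
  set M : ℂ → ℂ := fun t =>
    ∫ u in Set.Ioo (0 : ℝ) 1, (u : ℂ) ^ (t - 1) * saigoKernel A A' B B' G u with hM
  -- In the form `M * P = Q` only the entire function `1 / Γ` appears, so continuation meets no
  -- poles; `P ρ ≠ 0` is needed only at the end.
  let P : ℂ → ℂ := fun t => (Complex.Gamma t)⁻¹ * (Complex.Gamma (t + G - A - A' - B))⁻¹ *
    (Complex.Gamma (t + B' - A'))⁻¹
  let Q : ℂ → ℂ := fun t => Complex.Gamma G * ((Complex.Gamma (t + B'))⁻¹ *
    (Complex.Gamma (t + G - A - A'))⁻¹ * (Complex.Gamma (t + G - A' - B))⁻¹)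
  have hΓ : ∀ f : ℂ → ℂ, Differentiable ℂ f →
      Differentiable ℂ fun t => (Complex.Gamma (f t))⁻¹ := fun f hf =>
    Complex.differentiable_one_div_Gamma.comp hf
  have hP : Differentiable ℂ P := ((hΓ _ (by fun_prop)).mul (hΓ _ (by fun_prop))).mul
    (hΓ _ (by fun_prop))
  have hQ : Differentiable ℂ Q := (((hΓ _ (by fun_prop)).mul (hΓ _ (by fun_prop))).mul
    (hΓ _ (by fun_prop))).const_mul _
  set H : Set ℂ := {t | ρ.re < t.re} with hH
  have hHo : IsOpen H := isOpen_lt continuous_const Complex.continuous_re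
  have hL : AnalyticOnNhd ℂ (fun t => M t * P t) H :=
    ((differentiableOn_setIntegral_cpow_mul hK hint).mul hP.differentiableOn).analyticOnNhd hHo
  have hR : AnalyticOnNhd ℂ Q H := hQ.differentiableOn.analyticOnNhd hHo
  set T : ℝ := ‖A‖ + ‖A'‖ + ‖B‖ + ‖G - B'‖ + 1 with hT
  set t₀ : ℝ := max T ρ.re + 1 with ht₀
  have hev : (fun t => M t * P t) =ᶠ[𝓝 (t₀ : ℂ)] Q := by
    have : ∀ᶠ t : ℂ in 𝓝 (t₀ : ℂ), T < t.re :=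
      (isOpen_lt continuous_const Complex.continuous_re).mem_nhds (by
        change T < (t₀ : ℂ).re
        rw [Complex.ofReal_re, ht₀]
        linarith [le_max_left T ρ.re])
    filter_upwards [this] with t ht
    have a1 := Complex.re_le_norm A
    have a2 := Complex.re_le_norm A'
    have a3 := Complex.re_le_norm B
    have a4 := Complex.re_le_norm (G - B')
    rw [Complex.sub_re] at a4
    have b1 := norm_nonneg A
    have b2 := norm_nonneg A'
    have b3 := norm_nonneg B
    have b4 := norm_nonneg (G - B')
    have g1 : Complex.Gamma t ≠ 0 := Complex.Gamma_ne_zero_of_re_pos (by linarith)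
    have g2 : Complex.Gamma (t + G - A - A' - B) ≠ 0 := Complex.Gamma_ne_zero_of_re_pos (by
      simp only [Complex.add_re, Complex.sub_re]; linarith)
    have g3 : Complex.Gamma (t + B' - A') ≠ 0 := Complex.Gamma_ne_zero_of_re_pos (by
      simp only [Complex.add_re, Complex.sub_re]; linarith)
    simp only [hM, P, Q]
    rw [(mellin_saigoKernel_of_large A A' B B' hG ht).2]
    field_simp
  have heq := hL.eqOn_of_preconnected_of_eventuallyEq hR
    (convex_halfSpace_re_gt ρ.re).isPreconnected (z₀ := (t₀ : ℂ)) (by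
      change ρ.re < (t₀ : ℂ).re
      rw [Complex.ofReal_re, ht₀]
      linarith [le_max_right T ρ.re]) hev
  have hseq : Filter.Tendsto (fun n : ℕ => ρ + ((1 / ((n : ℝ) + 1) : ℝ) : ℂ)) Filter.atTop
      (𝓝 ρ) := by
    simpa using ((Complex.continuous_ofReal.tendsto _).comp
      tendsto_one_div_add_atTop_nhds_zero_nat).const_add ρ
  have hlim1 := (tendsto_setIntegral_cpow_mul hK hint).mul ((hP.continuous.tendsto ρ).comp hseq)
  have hlim2 := (hQ.continuous.tendsto ρ).comp hseq
  have hfin : M ρ * P ρ = Q ρ := by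
    refine tendsto_nhds_unique hlim1 (hlim2.congr fun n => ?_)
    refine (heq (x := ρ + ((1 / ((n : ℝ) + 1) : ℝ) : ℂ)) ?_).symm
    change ρ.re < (ρ + ((1 / ((n : ℝ) + 1) : ℝ) : ℂ)).re
    rw [Complex.add_re, Complex.ofReal_re]
    have : 0 < 1 / ((n : ℝ) + 1) := by positivity
    linarith
  have g1 := Gamma_ne_zero_of_not_isGammaPole h1
  have g2 := Gamma_ne_zero_of_not_isGammaPole h2
  have g3 := Gamma_ne_zero_of_not_isGammaPole h3
  change M ρ = _
  have hP0 : P ρ ≠ 0 := mul_ne_zero (mul_ne_zero (inv_ne_zero g1) (inv_ne_zero g2))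
    (inv_ne_zero g3)
  rw [← mul_left_inj' hP0, hfin]
  simp only [P, Q, div_eq_mul_inv, mul_inv]
  field_simp

/-! ### Rescaling to the unit interval. -/

theorem setIntegral_Ioo_comp_mul_left (F : ℝ → ℂ) {x : ℝ} (hx : 0 < x) :
    ∫ t in Set.Ioo 0 x, F t = x * ∫ u in Set.Ioo (0 : ℝ) 1, F (x * u) := by
  rw [← integral_Ioc_eq_integral_Ioo, ← integral_Ioc_eq_integral_Ioo,
    ← intervalIntegral.integral_of_le hx.le, ← intervalIntegral.integral_of_le zero_le_one,
    ← Complex.real_smul, intervalIntegral.smul_integral_comp_mul_left, mul_zero, mul_one]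

theorem integrableOn_Ioo_comp_mul_left {F : ℝ → ℂ} {x : ℝ} (hx : 0 < x)
    (hF : IntegrableOn F (Set.Ioo 0 x)) :
    IntegrableOn (fun u => F (x * u)) (Set.Ioo 0 1) := by
  rw [← intervalIntegrable_iff_integrableOn_Ioo_of_le hx.le] at hF
  rw [← intervalIntegrable_iff_integrableOn_Ioo_of_le zero_le_one]
  simpa [hx.ne'] using hF.comp_mul_left (c := x)

theorem saigoMaedaIntegrand_mul (A A' B B' : ℂ) {G : ℂ} (hG : 0 < G.re) (f : ℝ → ℂ) {x u : ℝ}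
    (hx : 0 < x) (hu : u ∈ Set.Ioo 0 1) :
    saigoMaedaIntegrand A A' B B' G f x (x * u) =
      (x : ℂ) ^ (G - 1 - A') * (saigoKernel A A' B B' G u * f (x * u)) := by
  have hu1 : 0 ≤ 1 - u := by linarith [hu.2]
  have hxc : (x : ℂ) ≠ 0 := by exact_mod_cast hx.ne'
  have huc : (u : ℂ) ≠ 0 := by exact_mod_cast hu.1.ne'
  have h0 : (u : ℂ) ^ (-A') * (u : ℂ) ^ A' = 1 := by
    rw [← Complex.cpow_add _ _ huc, neg_add_cancel, Complex.cpow_zero]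
  rw [saigoMaedaIntegrand, mul_div_cancel_left₀ _ hx.ne', div_mul_cancel_left₀ hx.ne',
    ← one_div, appellF3_one_sub A A' B B' hG hu, saigoKernel,
    show x - x * u = x * (1 - u) by ring, Complex.ofReal_mul x (1 - u), Complex.ofReal_mul x u,
    Complex.mul_cpow_ofReal_nonneg hx.le hu1, Complex.mul_cpow_ofReal_nonneg hx.le hu.1.le,
    show G - 1 - A' = G - 1 + -A' by ring, Complex.cpow_add _ _ hxc]
  linear_combination ((x : ℂ) ^ (G - 1) * ((1 - u : ℝ) : ℂ) ^ (G - 1) * (x : ℂ) ^ (-A') *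
    pfaffSeries A A' B B' G ((1 - u : ℝ) : ℂ) ((1 - u : ℝ) : ℂ) * f (x * u)) * h0

theorem ofReal_mul_rpow_pow (W : ℝ) {μ u : ℝ} (hu : 0 < u) (j : ℕ) :
    ((W * u ^ μ : ℝ) : ℂ) ^ j = (W : ℂ) ^ j * (u : ℂ) ^ ((μ : ℂ) * j) := by
  rw [Complex.ofReal_mul, mul_pow, Complex.ofReal_cpow hu.le, ← Complex.cpow_mul_nat]

/-! ### Termwise integration of a power series against a kernel. -/

section PowerSeries

variable {K : ℝ → ℂ} {d : ℕ → ℂ} {σ : ℂ} {μ W : ℝ}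

theorem mul_rpow_mem_Icc (hμ : 0 < μ) (hW : 0 < W) {u : ℝ} (hu : u ∈ Set.Icc 0 1) :
    0 ≤ W * u ^ μ ∧ W * u ^ μ ≤ W :=
  ⟨mul_nonneg hW.le (Real.rpow_nonneg hu.1 μ),
    mul_le_of_le_one_right hW.le (Real.rpow_le_one hu.1 hu.2 hμ.le)⟩

theorem norm_mul_pow_le (hμ : 0 < μ) (hW : 0 < W) {u : ℝ} (hu : u ∈ Set.Icc 0 1) (w : ℂ)
    (j : ℕ) : ‖w * ((W * u ^ μ : ℝ) : ℂ) ^ j‖ ≤ ‖w‖ * W ^ j := by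
  obtain ⟨h0, h1⟩ := mul_rpow_mem_Icc hμ hW hu
  rw [norm_mul, norm_pow, Complex.norm_real, Real.norm_of_nonneg h0]
  gcongr

/-- Near the origin a power series is bounded below by its first non-zero term. -/
theorem exists_lower_bound_powerSeries (hμ : 0 < μ) (hW : 0 < W)
    (hd : Summable fun j => ‖d j‖ * W ^ j) {k : ℕ} (hk : d k ≠ 0) (hmin : ∀ j < k, d j = 0) :
    ∃ c > 0, ∃ δ ∈ Set.Ioo (0 : ℝ) 1, ∀ u ∈ Set.Ioo 0 δ,
      c * ‖((W * u ^ μ : ℝ) : ℂ) ^ k‖ ≤ ‖∑' j, d j * ((W * u ^ μ : ℝ) : ℂ) ^ j‖ := by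
  let e : ℝ → ℂ := fun u => ∑' i, d (i + k) * ((W * u ^ μ : ℝ) : ℂ) ^ i
  have hdk : Summable fun i => ‖d (i + k)‖ * W ^ i := by
    have := ((summable_nat_add_iff k).2 hd).mul_right ((W ^ k)⁻¹)
    refine this.congr fun i => ?_
    rw [pow_add]
    field_simp
  have he : ContinuousOn e (Set.Icc 0 1) := by
    refine continuousOn_tsum (fun i => Continuous.continuousOn ?_) hdk
      fun i u hu => norm_mul_pow_le hμ hW hu _ i
    have : Continuous fun u : ℝ => u ^ μ := Real.continuous_rpow_const hμ.le
    fun_prop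
  have he0 : e 0 = d k := by
    simp only [e, Real.zero_rpow hμ.ne', mul_zero, Complex.ofReal_zero]
    rw [tsum_eq_single 0 fun i hi => by rw [zero_pow hi, mul_zero]]
    simp
  have hk0 : 0 < ‖d k‖ := norm_pos_iff.2 hk
  have hev : ∀ᶠ u in 𝓝[Set.Icc 0 1] (0 : ℝ), ‖d k‖ / 2 < ‖e u‖ := by
    have h1 := (he 0 (by simp)).norm
    refine h1.eventually_const_lt ?_
    change ‖d k‖ / 2 < ‖e 0‖
    rw [he0]
    linarith
  rw [eventually_nhdsWithin_iff, Metric.eventually_nhds_iff] at hev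
  obtain ⟨δ, hδ, h⟩ := hev
  refine ⟨‖d k‖ / 2, by positivity, min δ (1 / 2), ⟨by positivity, ?_⟩, fun u hu => ?_⟩
  · exact (min_le_right _ _).trans_lt (by norm_num)
  have hu1 : u ∈ Set.Icc (0 : ℝ) 1 :=
    ⟨hu.1.le, by linarith [hu.2.trans_le (min_le_right δ (1 / 2))]⟩
  have hlow := h (y := u) (by
    rw [Real.dist_eq, sub_zero, abs_of_pos hu.1]; exact hu.2.trans_le (min_le_left _ _)) hu1
  have hs : Summable fun j => d j * ((W * u ^ μ : ℝ) : ℂ) ^ j :=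
    .of_norm_bounded hd fun j => norm_mul_pow_le hμ hW hu1 _ j
  have hfac : ∑' j, d j * ((W * u ^ μ : ℝ) : ℂ) ^ j = ((W * u ^ μ : ℝ) : ℂ) ^ k * e u := by
    rw [← hs.sum_add_tsum_nat_add k, Finset.sum_eq_zero, zero_add, ← tsum_mul_left]
    · exact tsum_congr fun i => by rw [pow_add]; ring
    · intro j hj
      rw [hmin j (Finset.mem_range.1 hj), zero_mul]
  rw [hfac, norm_mul, mul_comm]
  gcongr

/-- On `(0, δ)` the lower bound for the series passes integrability on to its first non-zero term.
On `[δ, 1)` powers of `u` are comparable, so an exponent large enough for `hlarge` controls the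
kernel up to `1`. -/
theorem integrableOn_leading_term (hK : ContinuousOn K (Set.Ioo 0 1)) {s₁ : ℝ}
    (hlarge : ∀ s : ℂ, s₁ < s.re →
      IntegrableOn (fun u : ℝ => (u : ℂ) ^ (s - 1) * K u) (Set.Ioo 0 1))
    (hμ : 0 < μ) (hW : 0 < W) (hd : Summable fun j => ‖d j‖ * W ^ j)
    (hint : IntegrableOn (fun u : ℝ => (u : ℂ) ^ (σ - 1) *
      (K u * ∑' j, d j * ((W * u ^ μ : ℝ) : ℂ) ^ j)) (Set.Ioo 0 1))
    {k : ℕ} (hk : d k ≠ 0) (hmin : ∀ j < k, d j = 0) :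
    IntegrableOn (fun u : ℝ => (u : ℂ) ^ (σ + μ * k - 1) * K u) (Set.Ioo 0 1) := by
  obtain ⟨c, hc, δ, ⟨hδ0, hδ1⟩, hlow⟩ := exists_lower_bound_powerSeries hμ hW hd hk hmin
  set a : ℂ := σ + μ * k with ha
  set s : ℝ := max s₁ a.re + 1 with hs
  have hs1 : s₁ < (s : ℂ).re := by rw [Complex.ofReal_re, hs]; linarith [le_max_left s₁ a.re]
  have hsa : a.re - s ≤ 0 := by rw [hs]; linarith [le_max_right s₁ a.re]
  have hbig := hlarge s hs1
  refine Integrable.mono' ((hint.norm.const_mul (1 / (c * W ^ k))).add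
    (hbig.norm.const_mul (δ ^ (a.re - s)))) (aestronglyMeasurable_cpow_mul hK _)
    ((ae_restrict_iff' measurableSet_Ioo).2 (.of_forall fun u hu => ?_))
  have hu0 : (u : ℂ) ≠ 0 := by exact_mod_cast hu.1.ne'
  rw [Pi.add_apply]
  by_cases huδ : u < δ
  · refine le_add_of_le_of_nonneg ?_ (by positivity)
    have h1 := hlow u ⟨hu.1, huδ⟩
    rw [ofReal_mul_rpow_pow W hu.1, norm_mul, norm_pow, Complex.norm_real,
      Real.norm_of_nonneg hW.le] at h1
    rw [show a - 1 = (σ - 1) + μ * k by rw [ha]; ring, Complex.cpow_add _ _ hu0]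
    simp only [norm_mul]
    rw [one_div_mul_eq_div, le_div_iff₀ (by positivity)]
    calc _ = ‖(u : ℂ) ^ (σ - 1)‖ * (‖K u‖ * (c * (W ^ k * ‖(u : ℂ) ^ ((μ : ℂ) * k)‖))) := by ring
      _ ≤ _ := by gcongr
  · refine le_add_of_nonneg_of_le (by positivity) ?_
    rw [norm_mul, norm_mul, ← mul_assoc]
    refine mul_le_mul_of_nonneg_right ?_ (norm_nonneg _)
    rw [Complex.norm_cpow_eq_rpow_re_of_pos hu.1, Complex.norm_cpow_eq_rpow_re_of_pos hu.1]
    calc u ^ (a - 1).re = u ^ (a.re - s) * u ^ ((s : ℂ) - 1).re := by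
          rw [← Real.rpow_add hu.1]
          congr 1
          simp
      _ ≤ _ := mul_le_mul_of_nonneg_right
          (Real.rpow_le_rpow_of_nonpos hδ0 (not_lt.1 huδ) hsa) (Real.rpow_nonneg hu.1.le _)

/-- Since `u < 1`, every later term is dominated by the leading one, whose norm integral serves as
`C`. -/
theorem integrableOn_term (hK : ContinuousOn K (Set.Ioo 0 1)) {s₁ : ℝ}
    (hlarge : ∀ s : ℂ, s₁ < s.re →
      IntegrableOn (fun u : ℝ => (u : ℂ) ^ (s - 1) * K u) (Set.Ioo 0 1))
    (hμ : 0 < μ) (hW : 0 < W) (hd : Summable fun j => ‖d j‖ * W ^ j)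
    (hint : IntegrableOn (fun u : ℝ => (u : ℂ) ^ (σ - 1) *
      (K u * ∑' j, d j * ((W * u ^ μ : ℝ) : ℂ) ^ j)) (Set.Ioo 0 1)) :
    ∃ C, ∀ j, d j ≠ 0 →
      IntegrableOn (fun u : ℝ => (u : ℂ) ^ (σ + μ * j - 1) * K u) (Set.Ioo 0 1) ∧
      ∫ u in Set.Ioo (0 : ℝ) 1, ‖(u : ℂ) ^ (σ + μ * j - 1) * K u‖ ≤ C := by
  classical
  by_cases hex : ∃ k, d k ≠ 0
  · set k := Nat.find hex with hk
    have hlead := integrableOn_leading_term hK hlarge hμ hW hd hint (Nat.find_spec hex)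
      fun j hj => not_not.1 (Nat.find_min hex hj)
    refine ⟨∫ u in Set.Ioo (0 : ℝ) 1, ‖(u : ℂ) ^ (σ + μ * k - 1) * K u‖, fun j hj => ?_⟩
    have hkj : (k : ℝ) ≤ j := by exact_mod_cast Nat.find_min' hex hj
    have hre : (σ + μ * k : ℂ).re ≤ (σ + μ * j : ℂ).re := by
      simp
      gcongr
    have hj' := integrableOn_cpow_mul_of_re_le hK hre hlead
    exact ⟨hj', setIntegral_mono_on hj'.norm hlead.norm measurableSet_Ioo
      fun u hu => norm_cpow_mul_le hre hu (K u)⟩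
  · exact ⟨0, fun j hj => (hex ⟨j, hj⟩).elim⟩

theorem setIntegral_cpow_mul_powerSeries (hK : ContinuousOn K (Set.Ioo 0 1)) {s₁ : ℝ}
    (hlarge : ∀ s : ℂ, s₁ < s.re →
      IntegrableOn (fun u : ℝ => (u : ℂ) ^ (s - 1) * K u) (Set.Ioo 0 1))
    (hμ : 0 < μ) (hW : 0 < W) (hd : Summable fun j => ‖d j‖ * W ^ j)
    (hint : IntegrableOn (fun u : ℝ => (u : ℂ) ^ (σ - 1) *
      (K u * ∑' j, d j * ((W * u ^ μ : ℝ) : ℂ) ^ j)) (Set.Ioo 0 1)) :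
    ∫ u in Set.Ioo (0 : ℝ) 1, (u : ℂ) ^ (σ - 1) *
      (K u * ∑' j, d j * ((W * u ^ μ : ℝ) : ℂ) ^ j) =
    ∑' j, d j * (W : ℂ) ^ j * ∫ u in Set.Ioo (0 : ℝ) 1, (u : ℂ) ^ (σ + μ * j - 1) * K u := by
  obtain ⟨C, hC⟩ := integrableOn_term hK hlarge hμ hW hd hint
  let F : ℕ → ℝ → ℂ := fun j u => d j * (W : ℂ) ^ j * ((u : ℂ) ^ (σ + μ * j - 1) * K u)
  have hF : ∀ j, Integrable (F j) (volume.restrict (Set.Ioo 0 1)) := by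
    intro j
    by_cases hj : d j = 0
    · simp [F, hj]
    · exact (hC j hj).1.const_mul _
  have hs : Summable fun j => ∫ u in Set.Ioo (0 : ℝ) 1, ‖F j u‖ := by
    refine (hd.mul_right |C|).of_nonneg_of_le (fun j => integral_nonneg fun _ => norm_nonneg _)
      fun j => ?_
    simp only [F, norm_mul (d j * (W : ℂ) ^ j)]
    rw [integral_const_mul, norm_mul, norm_pow, Complex.norm_real, Real.norm_of_nonneg hW.le]
    by_cases hj : d j = 0
    · simp [hj]
    · gcongr
      exact (hC j hj).2.trans (le_abs_self C)
  have h := integral_tsum_of_summable_integral_norm hF hs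
  simp only [F, integral_const_mul] at h
  rw [h]
  refine setIntegral_congr_fun measurableSet_Ioo fun u hu => ?_
  have hu0 : (u : ℂ) ≠ 0 := by exact_mod_cast hu.1.ne'
  rw [← mul_assoc, ← tsum_mul_left]
  refine tsum_congr fun j => ?_
  rw [ofReal_mul_rpow_pow W hu.1, show σ + μ * j - 1 = (σ - 1) + μ * j by ring,
    Complex.cpow_add _ _ hu0]
  ring

end PowerSeries

/-! ### The Saigo–Maeda integral of a power series. -/

/-- The Gamma factor by which the Saigo–Maeda integral multiplies the power `t ^ (ρ - 1)`. -/
noncomputable def saigoFactor (A A' B B' G ρ : ℂ) : ℂ :=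
  Complex.Gamma ρ * Complex.Gamma (ρ + G - A - A' - B) * Complex.Gamma (ρ + B' - A') /
    (Complex.Gamma (ρ + B') * Complex.Gamma (ρ + G - A - A') * Complex.Gamma (ρ + G - A' - B))

section

variable {A A' B B' G σ : ℂ} {μ x : ℝ} {d : ℕ → ℂ}

theorem saigoMaedaIntegrand_powerSeries (hG : 0 < G.re) (hx : 0 < x) {u : ℝ}
    (hu : u ∈ Set.Ioo 0 1) :
    saigoMaedaIntegrand A A' B B' G
        (fun t => (t : ℂ) ^ (σ - 1) * ∑' j, d j * ((t ^ μ : ℝ) : ℂ) ^ j) x (x * u) =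
      (x : ℂ) ^ (G - 1 - A' + (σ - 1)) * ((u : ℂ) ^ (σ - 1) * (saigoKernel A A' B B' G u *
        ∑' j, d j * ((x ^ μ * u ^ μ : ℝ) : ℂ) ^ j)) := by
  rw [saigoMaedaIntegrand_mul A A' B B' hG _ hx hu, Complex.ofReal_mul x u,
    Complex.mul_cpow_ofReal_nonneg hx.le hu.1.le, Real.mul_rpow hx.le hu.1.le,
    Complex.cpow_add _ _ (by exact_mod_cast hx.ne')]
  ring

theorem integrableOn_saigoKernel_mul_powerSeries (hG : 0 < G.re) (hx : 0 < x)
    (hint : IntegrableOn (saigoMaedaIntegrand A A' B B' G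
        (fun t => (t : ℂ) ^ (σ - 1) * ∑' j, d j * ((t ^ μ : ℝ) : ℂ) ^ j) x) (Set.Ioo 0 x)) :
    IntegrableOn (fun u : ℝ => (u : ℂ) ^ (σ - 1) * (saigoKernel A A' B B' G u *
        ∑' j, d j * ((x ^ μ * u ^ μ : ℝ) : ℂ) ^ j)) (Set.Ioo 0 1) := by
  have hx0 : (x : ℂ) ^ (G - 1 - A' + (σ - 1)) ≠ 0 := by
    simp [Complex.cpow_eq_zero_iff, hx.ne']
  have h1 := (integrableOn_Ioo_comp_mul_left hx hint).const_mul
    ((x : ℂ) ^ (G - 1 - A' + (σ - 1)))⁻¹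
  refine Integrable.congr h1 ((ae_restrict_iff' measurableSet_Ioo).2 (.of_forall fun u hu => ?_))
  simp only
  rw [saigoMaedaIntegrand_powerSeries hG hx hu, inv_mul_cancel_left₀ hx0]

/-- The Saigo–Maeda integral may be computed termwise where it converges absolutely. -/
theorem saigoMaedaIntegral_powerSeries (hG : 0 < G.re) (hμ : 0 < μ) (hx : 0 < x)
    (hd : Summable fun j => ‖d j‖ * (x ^ μ) ^ j)
    (hint : IntegrableOn (saigoMaedaIntegrand A A' B B' G
        (fun t => (t : ℂ) ^ (σ - 1) * ∑' j, d j * ((t ^ μ : ℝ) : ℂ) ^ j) x) (Set.Ioo 0 x))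
    (h1 : ∀ j : ℕ, ¬ IsGammaPole (σ + μ * j))
    (h2 : ∀ j : ℕ, ¬ IsGammaPole (σ + μ * j + G - A - A' - B))
    (h3 : ∀ j : ℕ, ¬ IsGammaPole (σ + μ * j + B' - A')) :
    (∃ C, ∀ j, d j ≠ 0 → ‖saigoFactor A A' B B' G (σ + μ * j)‖ ≤ C) ∧
    saigoMaedaIntegral A A' B B' G
        (fun t => (t : ℂ) ^ (σ - 1) * ∑' j, d j * ((t ^ μ : ℝ) : ℂ) ^ j) x =
      ∑' j, d j * saigoFactor A A' B B' G (σ + μ * j) *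
        (x : ℂ) ^ (σ + G - A - A' - 1 + μ * j) := by
  have hK := continuousOn_saigoKernel A A' B B' hG
  have hlarge := fun s hs => (mellin_saigoKernel_of_large A A' B B' hG (ρ := s) hs).1
  have hW : 0 < x ^ μ := Real.rpow_pos_of_pos hx μ
  have hint' := integrableOn_saigoKernel_mul_powerSeries hG hx hint
  have hG0 := Complex.Gamma_ne_zero_of_re_pos hG
  have hxc : (x : ℂ) ≠ 0 := by exact_mod_cast hx.ne'
  obtain ⟨C, hC⟩ := integrableOn_term hK hlarge hμ hW hd hint'
  -- Where `d j = 0` the Mellin integral may diverge, but the term vanishes on both sides.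
  have hM : ∀ j, d j ≠ 0 → ∫ u in Set.Ioo (0 : ℝ) 1, (u : ℂ) ^ (σ + μ * j - 1) *
      saigoKernel A A' B B' G u = Complex.Gamma G * saigoFactor A A' B B' G (σ + μ * j) :=
    fun j hj => mellin_saigoKernel A A' B B' hG (hC j hj).1 (h1 j) (h2 j) (h3 j)
  refine ⟨⟨C / ‖Complex.Gamma G‖, fun j hj => ?_⟩, ?_⟩
  · rw [le_div_iff₀ (norm_pos_iff.2 hG0), mul_comm, ← norm_mul, ← hM j hj]
    exact (norm_integral_le_integral_norm _).trans (hC j hj).2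
  · rw [saigoMaedaIntegral, setIntegral_Ioo_comp_mul_left _ hx,
      setIntegral_congr_fun measurableSet_Ioo
        (fun u hu => saigoMaedaIntegrand_powerSeries hG hx hu),
      integral_const_mul, setIntegral_cpow_mul_powerSeries hK hlarge hμ hW hd hint',
      ← tsum_mul_left, ← tsum_mul_left, ← tsum_mul_left]
    refine tsum_congr fun j => ?_
    by_cases hj : d j = 0
    · simp [hj]
    · have hexp : (x : ℂ) ^ (σ + G - A - A' - 1 + μ * j) =
          (x : ℂ) ^ (-A) * x * (x : ℂ) ^ (G - 1 - A' + (σ - 1)) * ((x ^ μ : ℝ) : ℂ) ^ j := by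
        rw [Complex.ofReal_cpow hx.le, ← Complex.cpow_mul_nat,
          show σ + G - A - A' - 1 + μ * j = -A + 1 + (G - 1 - A' + (σ - 1)) + μ * j by ring,
          Complex.cpow_add _ (μ * j : ℂ) hxc, Complex.cpow_add _ (G - 1 - A' + (σ - 1)) hxc,
          Complex.cpow_add (-A) 1 hxc, Complex.cpow_one]
      rw [hM j hj, hexp]
      field_simp

end

/-! ### Termwise differentiation of generalized power series. -/

section PowerSeriesDerivative

variable {μ b : ℝ} {e : ℕ → ℂ}

/-- The sum `∑ e j x ^ (s + μ j)`. -/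
noncomputable def genPowerSeries (μ : ℝ) (e : ℕ → ℂ) (s : ℂ) (x : ℝ) : ℂ :=
  ∑' j : ℕ, e j * (x : ℂ) ^ (s + μ * j)

theorem norm_genPowerSeries_term (e : ℕ → ℂ) (s : ℂ) {x : ℝ} (hx : 0 < x) (j : ℕ) :
    ‖e j * (x : ℂ) ^ (s + μ * j)‖ = x ^ s.re * (‖e j‖ * (x ^ μ) ^ j) := by
  rw [norm_mul, Complex.norm_cpow_eq_rpow_re_of_pos hx, ← Real.rpow_mul_natCast hx.le]
  have : (s + μ * j : ℂ).re = s.re + μ * j := by simp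
  rw [this, Real.rpow_add hx]
  ring

theorem summable_genPowerSeries (s : ℂ) {x : ℝ} (hx : 0 < x)
    (he : Summable fun j => ‖e j‖ * (x ^ μ) ^ j) :
    Summable fun j : ℕ => e j * (x : ℂ) ^ (s + μ * j) :=
  .of_norm ((he.mul_left (x ^ s.re)).congr fun j => (norm_genPowerSeries_term e s hx j).symm)

/-- A factor linear in `j` is absorbed by the geometric gain from a slightly larger point `y' < b`.
-/
theorem summable_linear_mul (hμ : 0 < μ) (s : ℂ)
    (he : ∀ y ∈ Set.Ioo 0 b, Summable fun j => ‖e j‖ * (y ^ μ) ^ j) :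
    ∀ y ∈ Set.Ioo 0 b, Summable fun j => ‖e j * (s + μ * j)‖ * (y ^ μ) ^ j := by
  intro y hy
  obtain ⟨y', hyy', hy'b⟩ := exists_between hy.2
  have hy'0 := hy.1.trans hyy'
  have hlt : y ^ μ < y' ^ μ := Real.rpow_lt_rpow hy.1.le hyy' hμ
  have p1 : 0 < y ^ μ := Real.rpow_pos_of_pos hy.1 μ
  have p2 : 0 < y' ^ μ := Real.rpow_pos_of_pos hy'0 μ
  set r := y ^ μ / y' ^ μ with hr
  have hr0 : 0 ≤ r := by positivity
  have hr1 : r < 1 := (div_lt_one p2).2 hlt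
  have hbdd : ∃ C, ∀ j : ℕ, (‖s‖ + μ * j) * r ^ j ≤ C := by
    have h1 : Filter.Tendsto (fun j : ℕ => ‖s‖ * r ^ j + μ * ((j : ℝ) * r ^ j)) Filter.atTop
        (𝓝 (‖s‖ * 0 + μ * 0)) :=
      ((tendsto_pow_atTop_nhds_zero_of_lt_one hr0 hr1).const_mul _).add
        ((tendsto_self_mul_const_pow_of_lt_one hr0 hr1).const_mul _)
    obtain ⟨C, hC⟩ := h1.bddAbove_range
    exact ⟨C, fun j => by
      have := hC ⟨j, rfl⟩
      simp only at this
      linarith⟩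
  obtain ⟨C, hC⟩ := hbdd
  refine ((he y' ⟨hy'0, hy'b⟩).mul_left C).of_nonneg_of_le (fun j => by positivity) fun j => ?_
  have hn : ‖s + μ * j‖ ≤ ‖s‖ + μ * j := by
    refine (norm_add_le _ _).trans ?_
    rw [norm_mul, Complex.norm_real, Complex.norm_natCast, Real.norm_of_nonneg hμ.le]
  have hpow : (y ^ μ) ^ j = r ^ j * (y' ^ μ) ^ j := by
    rw [← mul_pow, hr, div_mul_cancel₀ _ p2.ne']
  rw [norm_mul, hpow]
  calc ‖e j‖ * ‖s + μ * j‖ * (r ^ j * (y' ^ μ) ^ j)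
      ≤ ‖e j‖ * (‖s‖ + μ * j) * (r ^ j * (y' ^ μ) ^ j) := by gcongr
    _ = ((‖s‖ + μ * j) * r ^ j) * (‖e j‖ * (y' ^ μ) ^ j) := by ring
    _ ≤ _ := by gcongr; exact hC j

theorem hasDerivAt_genPowerSeries (hμ : 0 < μ) (s : ℂ)
    (he : ∀ y ∈ Set.Ioo 0 b, Summable fun j => ‖e j‖ * (y ^ μ) ^ j) {x : ℝ}
    (hx : x ∈ Set.Ioo 0 b) :
    HasDerivAt (genPowerSeries μ e s) (genPowerSeries μ (fun j => e j * (s + μ * j)) (s - 1) x)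
      x := by
  obtain ⟨y₂, hxy₂, hy₂b⟩ := exists_between hx.2
  obtain ⟨y₁, hy₁, hy₁x⟩ := exists_between hx.1
  have he' := summable_linear_mul hμ s he y₂ ⟨hx.1.trans hxy₂, hy₂b⟩
  obtain ⟨C, hC⟩ := isCompact_Icc.exists_bound_of_continuousOn (s := Set.Icc y₁ y₂)
    (f := fun y : ℝ => y ^ (s - 1).re) fun y hy =>
      (Real.continuousAt_rpow_const _ _ (Or.inl (hy₁.trans_le hy.1).ne')).continuousWithinAt
  refine hasDerivAt_tsum_of_isPreconnected (he'.mul_left C) isOpen_Ioo isPreconnected_Ioo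
    (t := Set.Ioo y₁ y₂) (y₀ := x) (g := fun j (y : ℝ) => e j * (y : ℂ) ^ (s + μ * j))
    (g' := fun j (y : ℝ) => e j * (s + μ * j) * (y : ℂ) ^ (s - 1 + μ * j)) (fun j y hy => ?_)
    (fun j y hy => ?_) ⟨hy₁x, hxy₂⟩ (summable_genPowerSeries s hx.1 (he x hx)) ⟨hy₁x, hxy₂⟩
  · have hy0 : 0 < y := hy₁.trans hy.1
    have h1 : HasDerivAt (fun w : ℂ => w ^ (s + μ * j))
        ((s + μ * j) * (y : ℂ) ^ (s + μ * j - 1) * 1) (y : ℂ) :=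
      (hasDerivAt_id (y : ℂ)).cpow_const (Or.inl (by simpa using hy0))
    refine (h1.comp_ofReal.const_mul (e j)).congr_deriv ?_
    rw [show s + μ * j - 1 = s - 1 + μ * j by ring]
    ring
  · have hy0 : 0 < y := hy₁.trans hy.1
    rw [norm_genPowerSeries_term (fun j => e j * (s + μ * j)) (s - 1) hy0]
    have h1 := (le_abs_self _).trans (hC y ⟨hy.1.le, hy.2.le⟩)
    have h2 : y ^ μ ≤ y₂ ^ μ := Real.rpow_le_rpow hy0.le hy.2.le hμ.le
    have h3 : 0 ≤ y ^ μ := Real.rpow_nonneg hy0.le μ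
    have h4 : 0 ≤ C := (norm_nonneg _).trans (hC y ⟨hy.1.le, hy.2.le⟩)
    gcongr

theorem contDiffOn_genPowerSeries (hμ : 0 < μ) (n : ℕ) (s : ℂ)
    (he : ∀ y ∈ Set.Ioo 0 b, Summable fun j => ‖e j‖ * (y ^ μ) ^ j) :
    ContDiffOn ℝ n (genPowerSeries μ e s) (Set.Ioo 0 b) := by
  have hdiff : ∀ (e : ℕ → ℂ) (s : ℂ),
      (∀ y ∈ Set.Ioo 0 b, Summable fun j => ‖e j‖ * (y ^ μ) ^ j) →
      DifferentiableOn ℝ (genPowerSeries μ e s) (Set.Ioo 0 b) := fun e s he x hx =>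
    (hasDerivAt_genPowerSeries hμ s he hx).differentiableAt.differentiableWithinAt
  induction n generalizing e s with
  | zero => exact contDiffOn_zero.2 (hdiff e s he).continuousOn
  | succ n ih =>
    refine (contDiffOn_succ_iff_deriv_of_isOpen (n := n) isOpen_Ioo).2
      ⟨hdiff e s he, fun h => by simp at h, ?_⟩
    exact (ih (s - 1) (summable_linear_mul hμ s he)).congr fun x hx =>
      (hasDerivAt_genPowerSeries hμ s he hx).deriv

theorem summable_poch_mul (hμ : 0 < μ) (n : ℕ) (s : ℂ)
    (he : ∀ y ∈ Set.Ioo 0 b, Summable fun j => ‖e j‖ * (y ^ μ) ^ j) :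
    ∀ y ∈ Set.Ioo 0 b, Summable fun j => ‖e j * poch (s + μ * j) n‖ * (y ^ μ) ^ j := by
  induction n with
  | zero => simpa [poch_zero] using he
  | succ n ih =>
    have := summable_linear_mul hμ (s + n) ih
    intro y hy
    refine (this y hy).congr fun j => ?_
    rw [poch_succ, show s + n + μ * j = s + μ * j + n by ring, mul_assoc]

/-- The starting exponent `s + n - 1` makes the descending factors assemble into the rising
factorial of `s + μ j`. -/
theorem iteratedDeriv_genPowerSeries (hμ : 0 < μ) (n : ℕ) (s : ℂ)
    (he : ∀ y ∈ Set.Ioo 0 b, Summable fun j => ‖e j‖ * (y ^ μ) ^ j) {x : ℝ}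
    (hx : x ∈ Set.Ioo 0 b) :
    iteratedDeriv n (genPowerSeries μ e (s + n - 1)) x =
      genPowerSeries μ (fun j => e j * poch (s + μ * j) n) (s - 1) x := by
  induction n generalizing e with
  | zero => simp [poch_zero]
  | succ n ih =>
    have hev : deriv (genPowerSeries μ e (s + (n + 1 : ℕ) - 1)) =ᶠ[𝓝 x]
        genPowerSeries μ (fun j => e j * (s + n + μ * j)) (s + n - 1) := by
      filter_upwards [isOpen_Ioo.mem_nhds hx] with y hy
      rw [(hasDerivAt_genPowerSeries hμ _ he hy).deriv]
      rw [show s + (n + 1 : ℕ) - 1 = s + n by push_cast; ring]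
    rw [iteratedDeriv_succ', hev.iteratedDeriv_eq, ih (summable_linear_mul hμ _ he)]
    congr 1
    funext j
    rw [poch_succ]
    ring

end PowerSeriesDerivative

/-! ### The Saigo–Maeda derivative of a power series. -/

section

variable {α α' β β' γ σ : ℂ} {μ z : ℝ} {d : ℕ → ℂ}

/-- The Gamma factor by which the Saigo–Maeda derivative multiplies the power `t ^ (ρ - 1)`. -/
noncomputable def saigoDerivFactor (α α' β β' γ ρ : ℂ) : ℂ :=
  Complex.Gamma ρ * Complex.Gamma (ρ + α + α' + β' - γ) * Complex.Gamma (ρ + α - β) /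
    (Complex.Gamma (ρ + α + α' - γ) * Complex.Gamma (ρ + α + β' - γ) * Complex.Gamma (ρ - β))

/-- With these parameters `n` cancels from every Gamma except `Γ(ρ + α + α' - γ + n)` in the
denominator, and the functional equation of `1 / Γ` removes it there, poles included. -/
theorem saigoFactor_mul_poch (α α' β β' γ ρ : ℂ) (n : ℕ) :
    saigoFactor (-α') (-α) (-β' + n) (-β) (-γ + n) ρ * poch (ρ + α + α' - γ) n =
      saigoDerivFactor α α' β β' γ ρ := by
  have h := poch_div_Gamma_add_natCast (ρ + α + α' - γ) n
  rw [saigoFactor, saigoDerivFactor,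
    show ρ + (-γ + n) - -α' - -α - (-β' + n) = ρ + α + α' + β' - γ by ring,
    show ρ + -β - -α = ρ + α - β by ring, show ρ + -β = ρ - β by ring,
    show ρ + (-γ + n) - -α' - -α = ρ + α + α' - γ + n by ring,
    show ρ + (-γ + n) - -α - (-β' + n) = ρ + α + β' - γ by ring]
  simp only [div_eq_mul_inv, mul_inv, one_mul] at h ⊢
  linear_combination (Complex.Gamma ρ * Complex.Gamma (ρ + α + α' + β' - γ) *
    Complex.Gamma (ρ + α - β) * (Complex.Gamma (ρ + α + β' - γ))⁻¹ *
    (Complex.Gamma (ρ - β))⁻¹) * h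

theorem saigoMaedaOrder_sub_re_pos (γ : ℂ) : 0 < (-γ + saigoMaedaOrder γ : ℂ).re := by
  have := Nat.lt_floor_add_one γ.re
  simp only [saigoMaedaOrder, Complex.add_re, Complex.neg_re, Complex.natCast_re]
  push_cast
  linarith

/-- The Saigo–Maeda derivative may be computed termwise. -/
theorem saigoMaedaDeriv_powerSeries (hμ : 0 < μ) (hz : 0 < z)
    (hex : ∀ᶠ x in 𝓝 z, (∀ t ∈ Set.Ioo 0 x, Summable fun j => d j * ((t ^ μ : ℝ) : ℂ) ^ j) ∧
      SaigoMaedaPrimitiveExists α α' β β' γ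
        (fun t => (t : ℂ) ^ (σ - 1) * ∑' j, d j * ((t ^ μ : ℝ) : ℂ) ^ j) x)
    (h1 : ∀ j : ℕ, ¬ IsGammaPole (σ + μ * j))
    (h2 : ∀ j : ℕ, ¬ IsGammaPole (σ + α + α' + β' - γ + μ * j))
    (h3 : ∀ j : ℕ, ¬ IsGammaPole (σ + α - β + μ * j)) :
    ContDiffAt ℝ (saigoMaedaOrder γ) (saigoMaedaPrimitive α α' β β' γ
      (fun t => (t : ℂ) ^ (σ - 1) * ∑' j, d j * ((t ^ μ : ℝ) : ℂ) ^ j)) z ∧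
    (Summable fun j : ℕ => d j * saigoDerivFactor α α' β β' γ (σ + μ * j) *
      ((z ^ μ : ℝ) : ℂ) ^ j) ∧
    saigoMaedaDeriv α α' β β' γ
      (fun t => (t : ℂ) ^ (σ - 1) * ∑' j, d j * ((t ^ μ : ℝ) : ℂ) ^ j) z =
      (z : ℂ) ^ (σ + α + α' - γ - 1) * ∑' j : ℕ,
        d j * saigoDerivFactor α α' β β' γ (σ + μ * j) * ((z ^ μ : ℝ) : ℂ) ^ j := by
  set n := saigoMaedaOrder γ with hn
  set f : ℝ → ℂ := fun t => (t : ℂ) ^ (σ - 1) * ∑' j, d j * ((t ^ μ : ℝ) : ℂ) ^ j with hf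
  obtain ⟨δ, hδ, hball⟩ := Metric.eventually_nhds_iff.1 hex
  set b : ℝ := z + δ with hb
  have hzb : z ∈ Set.Ioo 0 b := ⟨hz, by rw [hb]; linarith⟩
  have hd : ∀ y ∈ Set.Ioo 0 b, Summable fun j => ‖d j‖ * (y ^ μ) ^ j := by
    intro y hy
    -- A point `x` beyond both `y` and `z`, still within `δ` of `z`, so that the proviso at `x`
    -- covers `y`.
    obtain ⟨x, hx, hxb⟩ := exists_between (max_lt hy.2 hzb.2)
    have hxy := (le_max_left y z).trans_lt hx
    have hxz := (le_max_right y z).trans_lt hx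
    have := (hball (y := x) (by rw [Real.dist_eq, abs_of_pos (by linarith)]; linarith)).1 y
      ⟨hy.1, hxy⟩
    refine this.norm.congr fun j => ?_
    rw [norm_mul, norm_pow, Complex.norm_real, Real.norm_of_nonneg (Real.rpow_nonneg hy.1.le μ)]
  have hG : 0 < (-γ + n : ℂ).re := saigoMaedaOrder_sub_re_pos γ
  let e : ℕ → ℂ := fun j => d j * saigoFactor (-α') (-α) (-β' + n) (-β) (-γ + n) (σ + μ * j)
  have hterm : ∀ x, 0 < x → dist x z < δ →
      (∃ C, ∀ j, d j ≠ 0 → ‖saigoFactor (-α') (-α) (-β' + n) (-β) (-γ + n) (σ + μ * j)‖ ≤ C) ∧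
      saigoMaedaPrimitive α α' β β' γ f x =
        genPowerSeries μ e (σ + α + α' - γ + n - 1) x := by
    intro x hx hxz
    have hxb : x < b := by
      rw [Real.dist_eq] at hxz
      linarith [le_abs_self (x - z)]
    have := saigoMaedaIntegral_powerSeries (A := -α') (A' := -α) (B := -β' + n) (B' := -β)
      (σ := σ) hG hμ hx (hd x ⟨hx, hxb⟩) (hball hxz).2 h1
      (fun j => by
        convert h2 j using 2
        ring)
      (fun j => by
        convert h3 j using 2
        ring)
    refine ⟨this.1, this.2.trans ?_⟩
    rw [genPowerSeries, show σ + (-γ + n) - -α' - -α - 1 = σ + α + α' - γ + n - 1 by ring]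
  -- The Gamma factors do not involve `x`, so their bound obtained at `z` serves on all of `(0, b)`.
  obtain ⟨C, hC⟩ := (hterm z hz (by simpa using hδ)).1
  have he : ∀ y ∈ Set.Ioo 0 b, Summable fun j => ‖e j‖ * (y ^ μ) ^ j := by
    intro y hy
    have hyμ : 0 ≤ y ^ μ := Real.rpow_nonneg hy.1.le μ
    refine ((hd y hy).mul_left |C|).of_nonneg_of_le (fun j => by positivity) fun j => ?_
    simp only [e]
    by_cases hj : d j = 0
    · simp [hj]
    · rw [norm_mul, ← mul_assoc, mul_comm |C|]
      gcongr
      exact (hC j hj).trans (le_abs_self C)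
  have hev : saigoMaedaPrimitive α α' β β' γ f =ᶠ[𝓝 z]
      genPowerSeries μ e (σ + α + α' - γ + n - 1) := by
    filter_upwards [lt_mem_nhds hz, Metric.ball_mem_nhds z hδ] with x hx hxz
    exact (hterm x hx hxz).2
  have hpoch : ∀ j : ℕ, e j * poch (σ + α + α' - γ + μ * j) n =
      d j * saigoDerivFactor α α' β β' γ (σ + μ * j) := by
    intro j
    rw [← saigoFactor_mul_poch α α' β β' γ (σ + μ * j) n,
      show σ + μ * j + α + α' - γ = σ + α + α' - γ + μ * j by ring, ← mul_assoc]
  have hzμ : 0 ≤ z ^ μ := Real.rpow_nonneg hz.le μ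
  refine ⟨?_, ?_, ?_⟩
  · exact ((contDiffOn_genPowerSeries hμ n _ he).contDiffAt (isOpen_Ioo.mem_nhds hzb)).congr_of_eventuallyEq
      hev
  · refine Summable.of_norm ((summable_poch_mul hμ n (σ + α + α' - γ) he z hzb).congr fun j => ?_)
    rw [hpoch, norm_mul _ (((z ^ μ : ℝ) : ℂ) ^ j), norm_pow, Complex.norm_real,
      Real.norm_of_nonneg hzμ]
  · rw [saigoMaedaDeriv, ← hn, hev.iteratedDeriv_eq, iteratedDeriv_genPowerSeries hμ n _ he hzb,
      genPowerSeries, ← tsum_mul_left]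
    refine tsum_congr fun j => ?_
    rw [hpoch, Complex.cpow_add _ _ (by exact_mod_cast hz.ne'), Complex.ofReal_cpow hz.le,
      ← Complex.cpow_mul_nat]
    ring

end

/-! ### The `M`-series, the `K`-function and the Fox–Wright series. -/

theorem mSeriesTerm_eq_kFunctionTerm {p q : ℕ} (a : Fin p → ℂ) (b : Fin q → ℂ) (ξ η : ℂ) :
    mSeriesTerm a b ξ η = kFunctionTerm a b ξ η 1 := by
  funext w j
  have : (j.factorial : ℂ) ≠ 0 := by exact_mod_cast j.factorial_ne_zero
  rw [mSeriesTerm, kFunctionTerm, poch_one]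
  field_simp

theorem mSeries_eq_kFunction {p q : ℕ} (a : Fin p → ℂ) (b : Fin q → ℂ) (ξ η : ℂ) :
    mSeries a b ξ η = kFunction a b ξ η 1 := by
  funext w
  rw [mSeries, kFunction, mSeriesTerm_eq_kFunctionTerm]

/-- Parameters of slope `1` give `Γ(a + n) = (a)_n Γ(a)`; those of slope `μ` are exactly the
derivative's Gamma factor, and `(η, ξ)` belongs to the `K`-term. -/
theorem foxWrightTerm_topParams_bottomParams {p q : ℕ} {a : Fin p → ℂ} {b : Fin q → ℂ}
    (α α' β β' γ η ξ σ : ℂ) {ν : ℂ} (μ : ℝ) (ha : ∀ i, ¬ IsGammaPole (a i))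
    (hb : ∀ j, ¬ IsGammaPole (b j)) (hν : 0 < ν.re) (w : ℂ) (n : ℕ) :
    foxWrightTerm (topParams a α α' β β' γ σ ν μ) (bottomParams b α α' β β' γ σ η ξ μ) w n =
      (∏ i, Complex.Gamma (a i)) / (∏ j, Complex.Gamma (b j)) * Complex.Gamma ν *
        (kFunctionTerm a b ξ η ν w n * saigoDerivFactor α α' β β' γ (σ + μ * n)) := by
  simp only [foxWrightTerm, topParams, bottomParams, Fin.prod_univ_add, Fin.append_left,
    Fin.append_right, Fin.prod_univ_four, Matrix.cons_val, one_mul]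
  rw [Finset.prod_congr rfl fun i _ => Gamma_add_natCast (ha i) n,
    Finset.prod_congr rfl fun j _ => Gamma_add_natCast (hb j) n, Finset.prod_mul_distrib,
    Finset.prod_mul_distrib, Gamma_add_natCast (not_isGammaPole_of_re_pos hν), kFunctionTerm,
    saigoDerivFactor, show σ + μ * n + α + α' + β' - γ = σ + α + α' + β' - γ + μ * n by ring,
    show σ + μ * n + α - β = σ + α - β + μ * n by ring,
    show σ + μ * n + α + α' - γ = σ + α + α' - γ + μ * n by ring,
    show σ + μ * n + α + β' - γ = σ + α + β' - γ + μ * n by ring,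
    show σ + μ * n - β = σ - β + μ * n by ring, add_comm η]
  simp only [div_eq_mul_inv, mul_inv]
  ring

/-- The Saigo–Maeda derivative of the `K`-function. -/
theorem saigoMaedaDeriv_kFunction {p q : ℕ} {a : Fin p → ℂ} {b : Fin q → ℂ}
    {α α' β β' γ η ν ξ σ : ℂ} {μ c z : ℝ} (hν : 0 < ν.re) (hμ : 0 < μ)
    (hz : 0 < z) (ha : ∀ i, ¬ IsGammaPole (a i)) (hb : ∀ j, ¬ IsGammaPole (b j))
    (hex : ∀ᶠ x in 𝓝 z,
      (∀ t ∈ Set.Ioo 0 x, Summable (kFunctionTerm a b ξ η ν ((c * t ^ μ : ℝ) : ℂ))) ∧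
      SaigoMaedaPrimitiveExists α α' β β' γ
        (fun t => (t : ℂ) ^ (σ - 1) * kFunction a b ξ η ν ((c * t ^ μ : ℝ) : ℂ)) x)
    (hdef : FoxWrightDefined (topParams a α α' β β' γ σ ν μ)) :
    ContDiffAt ℝ (saigoMaedaOrder γ)
      (saigoMaedaPrimitive α α' β β' γ
        (fun t => (t : ℂ) ^ (σ - 1) * kFunction a b ξ η ν ((c * t ^ μ : ℝ) : ℂ))) z ∧
    Summable (foxWrightTerm (topParams a α α' β β' γ σ ν μ)
      (bottomParams b α α' β β' γ σ η ξ μ) ((c * z ^ μ : ℝ) : ℂ)) ∧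
    saigoMaedaDeriv α α' β β' γ
        (fun t => (t : ℂ) ^ (σ - 1) * kFunction a b ξ η ν ((c * t ^ μ : ℝ) : ℂ)) z =
      (∏ j, Complex.Gamma (b j)) / (∏ i, Complex.Gamma (a i)) *
        ((z : ℂ) ^ (σ + α + α' - γ - 1) / Complex.Gamma ν) *
        foxWright (topParams a α α' β β' γ σ ν μ) (bottomParams b α α' β β' γ σ η ξ μ)
          ((c * z ^ μ : ℝ) : ℂ) := by
  -- The constant `c`, of either sign, goes into the coefficients, leaving a series in the positive
  -- variable `t ^ μ`.
  let d : ℕ → ℂ := fun j => kFunctionTerm a b ξ η ν c j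
  have hterm : ∀ (t : ℝ) (j : ℕ),
      kFunctionTerm a b ξ η ν ((c * t ^ μ : ℝ) : ℂ) j = d j * ((t ^ μ : ℝ) : ℂ) ^ j := by
    intro t j
    simp only [d, kFunctionTerm]
    rw [Complex.ofReal_mul, mul_pow]
    ring
  have hfun : (fun t : ℝ => (t : ℂ) ^ (σ - 1) * kFunction a b ξ η ν ((c * t ^ μ : ℝ) : ℂ)) =
      fun t : ℝ => (t : ℂ) ^ (σ - 1) * ∑' j, d j * ((t ^ μ : ℝ) : ℂ) ^ j := by
    funext t
    rw [kFunction]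
    simp only [hterm]
  have h1 : ∀ j : ℕ, ¬ IsGammaPole (σ + μ * j) := fun j => by
    simpa [topParams] using hdef (Fin.natAdd p 0) j
  have h2 : ∀ j : ℕ, ¬ IsGammaPole (σ + α + α' + β' - γ + μ * j) := fun j => by
    simpa [topParams] using hdef (Fin.natAdd p 1) j
  have h3 : ∀ j : ℕ, ¬ IsGammaPole (σ + α - β + μ * j) := fun j => by
    simpa [topParams] using hdef (Fin.natAdd p 2) j
  have hex' : ∀ᶠ x in 𝓝 z,
      (∀ t ∈ Set.Ioo 0 x, Summable fun j => d j * ((t ^ μ : ℝ) : ℂ) ^ j) ∧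
      SaigoMaedaPrimitiveExists α α' β β' γ
        (fun t => (t : ℂ) ^ (σ - 1) * ∑' j, d j * ((t ^ μ : ℝ) : ℂ) ^ j) x := by
    filter_upwards [hex] with x hx
    exact ⟨fun t ht => (hx.1 t ht).congr fun j => hterm t j, hfun ▸ hx.2⟩
  obtain ⟨r1, r2, r3⟩ := saigoMaedaDeriv_powerSeries hμ hz hex' h1 h2 h3
  have hfw : foxWrightTerm (topParams a α α' β β' γ σ ν μ) (bottomParams b α α' β β' γ σ η ξ μ)
      ((c * z ^ μ : ℝ) : ℂ) = fun j : ℕ =>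
      (∏ i, Complex.Gamma (a i)) / (∏ j, Complex.Gamma (b j)) * Complex.Gamma ν *
        (d j * saigoDerivFactor α α' β β' γ (σ + μ * j) * ((z ^ μ : ℝ) : ℂ) ^ j) := by
    funext j
    rw [foxWrightTerm_topParams_bottomParams α α' β β' γ η ξ σ μ ha hb hν, hterm]
    ring
  rw [hfun]
  refine ⟨r1, ?_, ?_⟩
  · rw [hfw]
    exact r2.mul_left _
  · have q1 : ∏ i, Complex.Gamma (a i) ≠ 0 :=
      Finset.prod_ne_zero_iff.2 fun i _ => Gamma_ne_zero_of_not_isGammaPole (ha i)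
    have q2 : ∏ j, Complex.Gamma (b j) ≠ 0 :=
      Finset.prod_ne_zero_iff.2 fun j _ => Gamma_ne_zero_of_not_isGammaPole (hb j)
    have q3 := Complex.Gamma_ne_zero_of_re_pos hν
    rw [r3, foxWright, hfw, tsum_mul_left]
    field_simp

theorem mainTheorem8 {p q : ℕ} (a : Fin p → ℂ) (b : Fin q → ℂ)
    (α α' β β' γ η ν ξ σ : ℂ) (μ c z : ℝ)
    (hν : 0 < ν.re) (hξ : 0 < ξ.re) (hγ : 0 < γ.re) (hμ : 0 < μ) (hz : 0 < z)
    -- the quotients `(a)_n / (b)_n`, `Γ(b) / Γ(a)` are defined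
    (ha : ∀ i, ¬ IsGammaPole (a i)) (hb : ∀ j, ¬ IsGammaPole (b j)) :
    -- the formula for the `M`-series, provided that each member exists
    ((∀ᶠ x in 𝓝 z,
        (∀ t ∈ Set.Ioo 0 x, Summable (mSeriesTerm a b ξ η ((c * t ^ μ : ℝ) : ℂ))) ∧
        SaigoMaedaPrimitiveExists α α' β β' γ
          (fun t => (t : ℂ) ^ (σ - 1) * mSeries a b ξ η ((c * t ^ μ : ℝ) : ℂ)) x) →
      FoxWrightDefined (topParams a α α' β β' γ σ 1 μ) →
      ContDiffAt ℝ (saigoMaedaOrder γ)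
        (saigoMaedaPrimitive α α' β β' γ
          (fun t => (t : ℂ) ^ (σ - 1) * mSeries a b ξ η ((c * t ^ μ : ℝ) : ℂ))) z ∧
      Summable (foxWrightTerm (topParams a α α' β β' γ σ 1 μ)
        (bottomParams b α α' β β' γ σ η ξ μ) ((c * z ^ μ : ℝ) : ℂ)) ∧
      saigoMaedaDeriv α α' β β' γ
          (fun t => (t : ℂ) ^ (σ - 1) * mSeries a b ξ η ((c * t ^ μ : ℝ) : ℂ)) z =
        (∏ j, Complex.Gamma (b j)) / (∏ i, Complex.Gamma (a i)) *
          (z : ℂ) ^ (σ + α + α' - γ - 1) *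
          foxWright (topParams a α α' β β' γ σ 1 μ) (bottomParams b α α' β β' γ σ η ξ μ)
            ((c * z ^ μ : ℝ) : ℂ)) ∧
    -- the formula for the `K`-function, provided that each member exists
    ((∀ᶠ x in 𝓝 z,
        (∀ t ∈ Set.Ioo 0 x, Summable (kFunctionTerm a b ξ η ν ((c * t ^ μ : ℝ) : ℂ))) ∧
        SaigoMaedaPrimitiveExists α α' β β' γ
          (fun t => (t : ℂ) ^ (σ - 1) * kFunction a b ξ η ν ((c * t ^ μ : ℝ) : ℂ)) x) →
      FoxWrightDefined (topParams a α α' β β' γ σ ν μ) →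
      ContDiffAt ℝ (saigoMaedaOrder γ)
        (saigoMaedaPrimitive α α' β β' γ
          (fun t => (t : ℂ) ^ (σ - 1) * kFunction a b ξ η ν ((c * t ^ μ : ℝ) : ℂ))) z ∧
      Summable (foxWrightTerm (topParams a α α' β β' γ σ ν μ)
        (bottomParams b α α' β β' γ σ η ξ μ) ((c * z ^ μ : ℝ) : ℂ)) ∧
      saigoMaedaDeriv α α' β β' γ
          (fun t => (t : ℂ) ^ (σ - 1) * kFunction a b ξ η ν ((c * t ^ μ : ℝ) : ℂ)) z =
        (∏ j, Complex.Gamma (b j)) / (∏ i, Complex.Gamma (a i)) *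
          ((z : ℂ) ^ (σ + α + α' - γ - 1) / Complex.Gamma ν) *
          foxWright (topParams a α α' β β' γ σ ν μ) (bottomParams b α α' β β' γ σ η ξ μ)
            ((c * z ^ μ : ℝ) : ℂ)) := by
  refine ⟨fun hex hdef => ?_, fun hex hdef => saigoMaedaDeriv_kFunction hν hμ hz ha hb hex hdef⟩
  rw [mSeriesTerm_eq_kFunctionTerm, mSeries_eq_kFunction] at hex
  have h := saigoMaedaDeriv_kFunction (by simp) hμ hz ha hb hex hdef
  rw [Complex.Gamma_one, div_one] at h
  rwa [mSeries_eq_kFunction]
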